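/- **Robustness implies decidability.** A *name* of a real number $a$ is a function $\gamma$ from $\mathbb{N}$ to the dyadic rationals with $|\gamma(i)-a|<2^{-i}$ for all $i$. A function $f:\mathbb{R}^k\to\mathbb{R}$ is *Type 2 computable* if some function-oracle machine, given names of the coordinates of an arbitrary point $x\in\mathbb{R}^k$ as its oracle and $i\in\mathbb{N}$ as its input, always halts and outputs a dyadic rational within distance less than $2^{-i}$ of $f(x)$. Let $\mathcal{F}$ be a collection of symbols for Type 2 computable functions $\mathbb{R}^k\to\mathbb{R}$, $k\ge 0$, that contains all rational constants, unary negation, addition and the absolute value. Terms are built from variables and symbols of $\mathcal{F}$. A *bounded $\mathcal{L}_{\mathcal{F}}$-sentence* is a sentence $$\varphi:\quad Q_1^{[u_1,v_1]}x_1\cdots Q_n^{[u_n,v_n]}x_n.\ \psi(x_1,\dots,x_n),\qquad Q_j\in\{\exists,\forall\},\ n\ge 0,$$ where $\psi$ is a combination by $\wedge$ and $\vee$ of atomic formulas $t>0$ and $t\ge 0$ with terms $t$, the bounds $u_j,v_j$ are terms in $x_1,\dots,x_{j-1}$, and the quantifier $Q_j^{[u_j,v_j]}x_j$ ranges over all real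 $x_j\in[u_j,v_j]$; here $[u,v]$ is read as $[v,u]$ when $v<u$. Sentences are interpreted in $\mathbb{R}$. For rational $\delta>0$, the $\delta$-weakening $\varphi^{-\delta}$ results from $\varphi$ by replacing each atomic formula $t>0$ of $\psi$ by $t>-\delta$ and each $t\ge 0$ by $t\ge-\delta$, the bounds $u_j,v_j$ being left unchanged, and $\varphi$ is *$\delta$-robust* if $\varphi^{-\delta}\rightarrow\varphi$ holds. There is an algorithm that, given a rational $\delta>0$ and a bounded $\delta$-robust $\mathcal{L}_{\mathcal{F}}$-sentence $\varphi$, in which every function symbol is given by a program of a function-oracle machine that computes the corresponding function, decides whether $\varphi$ is true or false. One and the same algorithm does this for all such collections $\mathcal{F}$. -/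

import Mathlib

universe u v

/-! ### Function-oracle machines -/

/-- Programs of function-oracle machines: programs for the functions that are partial recursive
relative to an oracle, built by the closure operations of `Nat.RecursiveIn` for a single oracle.
A program does not mention its oracle; the oracle is supplied when the program is run. -/
inductive OracleCode : Type
  | zero : OracleCode
  | succ : OracleCode
  | left : OracleCode
  | right : OracleCode
  | oracle : OracleCode
  | pair (c d : OracleCode) : OracleCode
  | comp (c d : OracleCode) : OracleCode
  | prec (c d : OracleCode) : OracleCode
  | rfind (c : OracleCode) : OracleCode

namespace OracleCode

/-- `c.eval O` is the partial function computed by the program `c` with oracle `O : ℕ → ℕ`. -/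
def eval (O : ℕ → ℕ) : OracleCode → ℕ →. ℕ
  | zero => fun _ => Part.some 0
  | succ => fun n => Part.some (n + 1)
  | left => fun n => Part.some (Nat.unpair n).1
  | right => fun n => Part.some (Nat.unpair n).2
  | oracle => fun n => Part.some (O n)
  | pair c d => fun n => (eval O c n).bind fun a => (eval O d n).map fun b => Nat.pair a b
  | comp c d => fun n => (eval O d n).bind fun a => eval O c a
  | prec c d => fun p =>
      Nat.rec (eval O c (Nat.unpair p).1)
        (fun y ih => ih.bind fun i =>
          eval O d (Nat.pair (Nat.unpair p).1 (Nat.pair y i)))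
        (Nat.unpair p).2
  | rfind c => fun a =>
      Nat.rfind fun n => (eval O c (Nat.pair a n)).map fun m => decide (m = 0)

/-- The Gödel number of a program. -/
def toNat : OracleCode → ℕ
  | zero => Nat.pair 0 0
  | succ => Nat.pair 1 0
  | left => Nat.pair 2 0
  | right => Nat.pair 3 0
  | oracle => Nat.pair 4 0
  | pair c d => Nat.pair 5 (Nat.pair c.toNat d.toNat)
  | comp c d => Nat.pair 6 (Nat.pair c.toNat d.toNat)
  | prec c d => Nat.pair 7 (Nat.pair c.toNat d.toNat)
  | rfind c => Nat.pair 8 c.toNat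

end OracleCode

/-! ### Type 2 computable real functions -/

/-- The dyadic rational `m / 2 ^ k` that is written as the pair `(m, k)`. -/
noncomputable def dyadicVal (d : ℤ × ℕ) : ℝ := (d.1 : ℝ) / 2 ^ d.2

/-- `γ` is a name of the real number `a`. -/
def IsName (γ : ℕ → ℤ × ℕ) (a : ℝ) : Prop :=
  ∀ i : ℕ, |dyadicVal (γ i) - a| < (2 : ℝ)⁻¹ ^ i

/-- The oracle given by names `γ 0, …, γ (n - 1)` of the coordinates of a vector: the answer to
the query `i` is the (coded) tuple `⟨γ 0 i, …, γ (n - 1) i⟩`. -/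
def nameOracle {n : ℕ} (γ : Fin n → ℕ → ℤ × ℕ) : ℕ → ℕ :=
  fun i => Encodable.encode (List.ofFn fun j => γ j i)

/-- The oracle machine with program `c` computes the real function `f : ℝⁿ → ℝ`: with any name
of any point `x` as its oracle, on every input `i` it halts and outputs a (coded) dyadic rational
that is within `2⁻ⁱ` of `f x`. -/
def OracleCode.Computes (c : OracleCode) {n : ℕ} (f : (Fin n → ℝ) → ℝ) : Prop :=
  ∀ (x : Fin n → ℝ) (γ : Fin n → ℕ → ℤ × ℕ), (∀ j, IsName (γ j) (x j)) →
    ∀ i : ℕ, ∃ d : ℤ × ℕ, Encodable.encode d ∈ c.eval (nameOracle γ) i ∧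
      |dyadicVal d - f x| < (2 : ℝ)⁻¹ ^ i

/-! ### Bounded formulas over the reals

A collection of symbols for real functions is given by the function symbols of a first-order
language `L` together with their interpretation, an `L`-structure on `ℝ`. Terms are the
`L`-terms; terms with free variables among `x₀, …, xₙ₋₁` are those of type `L.Term (Fin n)`. -/

namespace RealLogic

/-- The symbols that every collection of real functions is assumed to contain: all rational
constants (in particular `0`), unary negation, addition and the absolute value. -/
structure BasicSymbols (L : FirstOrder.Language.{u, v}) [L.Structure ℝ] where
  const : ℚ → L.Functions 0
  const_eval : ∀ (q : ℚ) (x : Fin 0 → ℝ), FirstOrder.Language.Structure.funMap (const q) x = (q : ℝ)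
  neg : L.Functions 1
  neg_eval : ∀ x : Fin 1 → ℝ, FirstOrder.Language.Structure.funMap neg x = -x 0
  add : L.Functions 2
  add_eval : ∀ x : Fin 2 → ℝ, FirstOrder.Language.Structure.funMap add x = x 0 + x 1
  abs : L.Functions 1
  abs_eval : ∀ x : Fin 1 → ℝ, FirstOrder.Language.Structure.funMap abs x = |x 0|

/-- The term `s - t`, that is `s + (-t)`. -/
def BasicSymbols.sub {L : FirstOrder.Language.{u, v}} [L.Structure ℝ] (B : BasicSymbols L) {α : Type}
    (s t : L.Term α) : L.Term α :=
  FirstOrder.Language.Term.func B.add ![s, FirstOrder.Language.Term.func B.neg ![t] ]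

/-- The constant term `q`. -/
def BasicSymbols.constTerm {L : FirstOrder.Language.{u, v}} [L.Structure ℝ] (B : BasicSymbols L) {α : Type}
    (q : ℚ) : L.Term α :=
  FirstOrder.Language.Term.func (B.const q) ![]

/-- Quantifier-free formulas in the variables `x₀, …, xₙ₋₁`: positive Boolean combinations of
atomic formulas `t > 0` and `t ≥ 0`. -/
inductive QFFormula (L : FirstOrder.Language.{u, v}) (n : ℕ) : Type u
  | pos (t : L.Term (Fin n)) : QFFormula L n
  | nonneg (t : L.Term (Fin n)) : QFFormula L n
  | and (φ ψ : QFFormula L n) : QFFormula L n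
  | or (φ ψ : QFFormula L n) : QFFormula L n

/-- Prenex formulas `Q^[a,b] xₙ … Q^[a',b'] xₘ₋₁. ψ` with bounded quantifiers and free variables
among `x₀, …, xₙ₋₁`. The terms that bound a quantifier contain neither the variable that it binds
nor any variable that is bound further inside. -/
inductive BddFormula (L : FirstOrder.Language.{u, v}) : ℕ → Type u
  | matrix {n : ℕ} (ψ : QFFormula L n) : BddFormula L n
  | ex {n : ℕ} (a b : L.Term (Fin n)) (φ : BddFormula L (n + 1)) : BddFormula L n
  | all {n : ℕ} (a b : L.Term (Fin n)) (φ : BddFormula L (n + 1)) : BddFormula L n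

/-- Bounded sentences. -/
abbrev BddSentence (L : FirstOrder.Language.{u, v}) : Type u := BddFormula L 0

section Semantics

variable {L : FirstOrder.Language.{u, v}} [L.Structure ℝ]

/-- Truth of a quantifier-free formula over the reals. -/
def QFFormula.Realize {n : ℕ} (x : Fin n → ℝ) : QFFormula L n → Prop
  | pos t => 0 < t.realize x
  | nonneg t => 0 ≤ t.realize x
  | and φ ψ => φ.Realize x ∧ ψ.Realize x
  | or φ ψ => φ.Realize x ∨ ψ.Realize x

/-- Truth of a bounded formula over the reals. Here `[a, b]` is read as `[b, a]` when `b < a`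
(`Set.uIcc a b` is the interval between `min a b` and `max a b`). -/
def BddFormula.Realize : {n : ℕ} → BddFormula L n → (Fin n → ℝ) → Prop
  | _, matrix ψ, x => ψ.Realize x
  | _, ex a b φ, x => ∃ y ∈ Set.uIcc (a.realize x) (b.realize x), φ.Realize (Fin.snoc x y)
  | _, all a b φ, x => ∀ y ∈ Set.uIcc (a.realize x) (b.realize x), φ.Realize (Fin.snoc x y)

/-- A bounded sentence is true. -/
def BddFormula.IsTrue (φ : BddSentence L) : Prop := φ.Realize ![]

/-- The `δ`-weakening of a quantifier-free formula: `t > 0` is replaced by `t > -δ`, which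
abbreviates `t - (-δ) > 0`, and `t ≥ 0` by `t ≥ -δ`, which abbreviates `t - (-δ) ≥ 0`. -/
def QFFormula.weaken (B : BasicSymbols L) (δ : ℚ) {n : ℕ} : QFFormula L n → QFFormula L n
  | pos t => pos (B.sub t (B.constTerm (-δ)))
  | nonneg t => nonneg (B.sub t (B.constTerm (-δ)))
  | and φ ψ => and (φ.weaken B δ) (ψ.weaken B δ)
  | or φ ψ => or (φ.weaken B δ) (ψ.weaken B δ)

/-- The `δ`-weakening of a bounded formula; the bounds on the quantifiers are not changed. -/
def BddFormula.weaken (B : BasicSymbols L) (δ : ℚ) : {n : ℕ} → BddFormula L n → BddFormula L n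
  | _, matrix ψ => matrix (ψ.weaken B δ)
  | _, ex a b φ => ex a b (φ.weaken B δ)
  | _, all a b φ => all a b (φ.weaken B δ)

/-- `φ` is `δ`-robust (under weakening): its `δ`-weakening implies `φ`. -/
def BddFormula.IsRobust (B : BasicSymbols L) (δ : ℚ) (φ : BddSentence L) : Prop :=
  (φ.weaken B δ).IsTrue → φ.IsTrue

end Semantics

section Coding

variable {L : FirstOrder.Language.{u, v}}

/-! Formulas as inputs of algorithms: the Gödel number of a formula, in which each function symbol
`f` is written as (the Gödel number of) a program `M f` of a machine that computes it. -/

/-- The Gödel number of a term. -/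
def termCode (M : ∀ k, L.Functions k → OracleCode) {n : ℕ} : L.Term (Fin n) → ℕ
  | .var i => Nat.pair 0 i
  | .func (l := l) f ts =>
      Nat.pair 1 (Nat.pair (M l f).toNat
        (Encodable.encode (List.ofFn fun i => termCode M (ts i))))

/-- The Gödel number of a quantifier-free formula. -/
def QFFormula.code (M : ∀ k, L.Functions k → OracleCode) {n : ℕ} : QFFormula L n → ℕ
  | pos t => Nat.pair 0 (termCode M t)
  | nonneg t => Nat.pair 1 (termCode M t)
  | and φ ψ => Nat.pair 2 (Nat.pair (φ.code M) (ψ.code M))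
  | or φ ψ => Nat.pair 3 (Nat.pair (φ.code M) (ψ.code M))

/-- The Gödel number of a bounded formula. -/
def BddFormula.code (M : ∀ k, L.Functions k → OracleCode) : {n : ℕ} → BddFormula L n → ℕ
  | _, matrix ψ => Nat.pair 0 (ψ.code M)
  | _, ex a b φ => Nat.pair 1 (Nat.pair (termCode M a) (Nat.pair (termCode M b) (φ.code M)))
  | _, all a b φ => Nat.pair 2 (Nat.pair (termCode M a) (Nat.pair (termCode M b) (φ.code M)))

end Coding

end RealLogic

/-! ### Primitive recursive functions -/

section PrimrecTools

variable {α β γ : Type*} [Primcodable α] [Primcodable β] [Primcodable γ]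

/-! Put `ε = 2⁻ᵉ` with `e = δ.den`, so that `ε ≤ δ`. Two certificates are searched for in parallel.
A positive one shows that `φ` holds with every atom read as `t > -ε`; then the `δ`-weakening holds,
and `φ` is true by robustness. A negative one shows that the dual of `φ` holds with every atom read
as `t < 0`; then `φ` is false. Both may exist, but no wrong answer can arise. At least one exists:
either `φ` with atoms `t > -ε` is true, or its dual with atoms `t ≤ -ε` is, and in each case
approximations of precision `ε` can certify the signs.

Certificates are finite because a halting oracle machine reads only a finite initial segment of its
names (`OracleCode.Yields.eventually_runs`). An approximation to a term at a point is therefore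
certified on all sufficiently small boxes around the point (`TermApprox.eventually`), which is the
effective form of the continuity of computable functions. Conversely, an initial segment of names
can be extended to names of any point of the box, so certificates about terms are correct
(`TermJudgment.holds_of_derivable`). For formulas, the interval of a quantifier is replaced by a
dyadic grid. An existential quantifier needs one grid ball; a universal one needs all of them, and
compactness of the interval supplies a common mesh (`BddDerivable.eventually_all`). Correctness and
existence of certificates for formulas are `FormulaJudgment.holds_of_derivable` and
`BddDerivable.eventually`.

Certificates are derivations in rule systems over Gödel numbers, in which the language does not
occur. Derivable statements can be enumerated (`EffectivelyEnumerable.derivable`), and the race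
between the two certificates (`EffectivelyEnumerable.exists_partrec_race`) is one algorithm for all
languages. -/

theorem Primrec.natPair_comp {f g : α → ℕ} (hf : Primrec f) (hg : Primrec g) :
    Primrec fun a => Nat.pair (f a) (g a) :=
  Primrec₂.natPair.comp hf hg

theorem Primrec.fst_comp {f : α → β × γ} (hf : Primrec f) : Primrec fun a => (f a).1 :=
  Primrec.fst.comp hf

theorem Primrec.snd_comp {f : α → β × γ} (hf : Primrec f) : Primrec fun a => (f a).2 :=
  Primrec.snd.comp hf

theorem Primrec.list_cons_comp {f : α → β} {g : α → List β} (hf : Primrec f) (hg : Primrec g) :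
    Primrec fun a => f a :: g a :=
  Primrec.list_cons.comp hf hg

theorem Primrec.list_append_comp {f g : α → List β} (hf : Primrec f) (hg : Primrec g) :
    Primrec fun a => f a ++ g a :=
  Primrec.list_append.comp hf hg

theorem Primrec.list_length_comp {f : α → List β} (hf : Primrec f) :
    Primrec fun a => (f a).length :=
  Primrec.list_length.comp hf

theorem Primrec.nat_add_comp {f g : α → ℕ} (hf : Primrec f) (hg : Primrec g) :
    Primrec fun a => f a + g a :=
  Primrec.nat_add.comp hf hg

theorem Primrec.nat_mul_comp {f g : α → ℕ} (hf : Primrec f) (hg : Primrec g) :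
    Primrec fun a => f a * g a :=
  Primrec.nat_mul.comp hf hg

theorem Primrec.two_pow_comp {f : α → ℕ} (hf : Primrec f) : Primrec fun a => 2 ^ f a := by
  have h : Primrec fun n : ℕ => 2 ^ n :=
    (Primrec.nat_rec₁ 1 (f := fun _ m => 2 * m)
      (Primrec.nat_mul.comp (Primrec.const 2) Primrec.snd)).of_eq fun n => by
        induction n with
        | zero => rfl
        | succ n ih => rw [pow_succ, mul_comm, ← ih]
  exact h.comp hf

theorem Primrec.encode_comp {f : α → β} (hf : Primrec f) :
    Primrec fun a => Encodable.encode (f a) :=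
  Primrec.encode.comp hf

theorem Primrec.sumInl_comp {f : α → β} (hf : Primrec f) :
    Primrec fun a => (Sum.inl (f a) : β ⊕ γ) :=
  Primrec.sumInl.comp hf

theorem Primrec.sumInr_comp {f : α → γ} (hf : Primrec f) :
    Primrec fun a => (Sum.inr (f a) : β ⊕ γ) :=
  Primrec.sumInr.comp hf

/-- Integers enter all later enumerations as differences of two natural numbers, so that only
arithmetic on `ℕ` has to be shown primitive recursive. The encoding of `ℤ` sends `n` to `2 * n` and
`-(k + 1)` to `2 * k + 1`. -/
theorem Primrec.int_subNatNat {f g : α → ℕ} (hf : Primrec f) (hg : Primrec g) :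
    Primrec fun a => Int.subNatNat (f a) (g a) := by
  have h : ∀ m n, Encodable.encode (Int.subNatNat m n) =
      if m < n then 2 * (n - m - 1) + 1 else 2 * (m - n) := by
    intro m n
    split_ifs with hmn
    · obtain ⟨k, rfl⟩ := Nat.exists_eq_add_of_lt hmn
      have : Int.subNatNat m (m + k + 1) = Int.negSucc k := by
        rw [Int.subNatNat_eq_coe, Int.negSucc_eq]; push_cast; ring
      rw [this, show m + k + 1 - m - 1 = k by omega]
      rfl
    · obtain ⟨k, rfl⟩ := Nat.exists_eq_add_of_le (not_lt.1 hmn)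
      have : Int.subNatNat (n + k) n = (k : ℤ) := by
        rw [Int.subNatNat_eq_coe]; push_cast; ring
      rw [this, Nat.add_sub_cancel_left]
      rfl
  refine Primrec.encode_iff.1 (Primrec.of_eq ?_ fun a => (h (f a) (g a)).symm)
  refine Primrec.ite (Primrec.nat_lt.comp hf hg) ?_ ?_
  · exact Primrec.succ.comp (Primrec.nat_mul.comp (Primrec.const 2)
      (Primrec.nat_sub.comp (Primrec.nat_sub.comp hg hf) (Primrec.const 1)))
  · exact Primrec.nat_mul.comp (Primrec.const 2) (Primrec.nat_sub.comp hf hg)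

end PrimrecTools

attribute [fun_prop] Primrec
attribute [fun_prop] Primrec.id Primrec.const Primrec.comp Primrec.pair
  Primrec.natPair_comp Primrec.fst_comp Primrec.snd_comp Primrec.list_cons_comp
  Primrec.list_append_comp Primrec.list_length_comp Primrec.nat_add_comp Primrec.nat_mul_comp
  Primrec.two_pow_comp Primrec.encode_comp Primrec.sumInl_comp Primrec.sumInr_comp
  Primrec.int_subNatNat

/-! ### Effectively enumerated sets -/

/-- A set that is the range of a primitive recursive partial enumeration. -/
def EffectivelyEnumerable {α : Type*} [Primcodable α] (s : Set α) : Prop :=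
  ∃ e : ℕ → Option α, Primrec e ∧ ∀ a, a ∈ s ↔ ∃ n, e n = some a

namespace EffectivelyEnumerable

variable {α β : Type*} [Primcodable α] [Primcodable β]

theorem univ : EffectivelyEnumerable (Set.univ : Set α) :=
  ⟨Encodable.decode, Primrec.decode, fun a => by
    simpa using ⟨Encodable.encode a, Encodable.encodek a⟩⟩

theorem image {s : Set α} (hs : EffectivelyEnumerable s) {f : α → β} (hf : Primrec f) :
    EffectivelyEnumerable (f '' s) := by
  obtain ⟨e, he, h⟩ := hs
  refine ⟨fun n => (e n).map f, Primrec.option_map he (hf.comp Primrec.snd), fun b => ?_⟩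
  simp only [Set.mem_image, h, Option.map_eq_some_iff]
  constructor
  · rintro ⟨a, ⟨n, hn⟩, rfl⟩; exact ⟨n, a, hn, rfl⟩
  · rintro ⟨n, a, hn, rfl⟩; exact ⟨a, ⟨n, hn⟩, rfl⟩

theorem range {f : α → β} (hf : Primrec f) : EffectivelyEnumerable (Set.range f) := by
  simpa using univ.image hf

theorem sep {s : Set α} (hs : EffectivelyEnumerable s) {p : α → Prop} (hp : PrimrecPred p) :
    EffectivelyEnumerable {a ∈ s | p a} := by
  classical
  obtain ⟨e, he, h⟩ := hs
  refine ⟨fun n => (e n).bind fun a => if p a then some a else none,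
    Primrec.option_bind he (Primrec.ite (hp.comp Primrec.snd)
      (Primrec.option_some.comp Primrec.snd) (Primrec.const none)), fun b => ?_⟩
  simp only [Set.mem_ofPred_eq, h, Option.bind_eq_some_iff]
  constructor
  · rintro ⟨⟨n, hn⟩, hb⟩; exact ⟨n, b, hn, by simp [hb]⟩
  · rintro ⟨n, a, hn, ha⟩
    split_ifs at ha with hpa
    cases ha
    exact ⟨⟨n, hn⟩, hpa⟩

theorem union {s t : Set α} (hs : EffectivelyEnumerable s) (ht : EffectivelyEnumerable t) :
    EffectivelyEnumerable (s ∪ t) := by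
  obtain ⟨e, he, h⟩ := hs
  obtain ⟨e', he', h'⟩ := ht
  refine ⟨fun n => if n.unpair.1 = 0 then e n.unpair.2 else e' n.unpair.2,
    Primrec.ite (Primrec.eq.comp (Primrec.fst.comp Primrec.unpair) (Primrec.const 0))
      (he.comp (Primrec.snd.comp Primrec.unpair)) (he'.comp (Primrec.snd.comp Primrec.unpair)),
    fun a => ?_⟩
  rw [Set.mem_union, h, h']
  constructor
  · rintro (⟨n, hn⟩ | ⟨n, hn⟩)
    · exact ⟨Nat.pair 0 n, by simpa using hn⟩
    · exact ⟨Nat.pair 1 n, by simpa using hn⟩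
  · rintro ⟨n, hn⟩
    dsimp only at hn
    split_ifs at hn
    · exact .inl ⟨_, hn⟩
    · exact .inr ⟨_, hn⟩

theorem prod {s : Set α} {t : Set β} (hs : EffectivelyEnumerable s)
    (ht : EffectivelyEnumerable t) : EffectivelyEnumerable (s ×ˢ t) := by
  obtain ⟨e, he, h⟩ := hs
  obtain ⟨e', he', h'⟩ := ht
  refine ⟨fun n => (e n.unpair.1).bind fun a => (e' n.unpair.2).map fun b => (a, b),
    Primrec.option_bind (he.comp (Primrec.fst.comp Primrec.unpair))
      (Primrec.option_map (he'.comp (Primrec.snd.comp (Primrec.unpair.comp Primrec.fst)))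
        (Primrec.pair (Primrec.snd.comp Primrec.fst) Primrec.snd)), fun ⟨a, b⟩ => ?_⟩
  rw [Set.mem_prod, h, h']
  simp only [Option.bind_eq_some_iff, Option.map_eq_some_iff, Prod.mk.injEq]
  constructor
  · rintro ⟨⟨m, hm⟩, ⟨n, hn⟩⟩
    exact ⟨Nat.pair m n, a, by simpa using hm, b, by simpa using hn, rfl, rfl⟩
  · rintro ⟨n, a', ha, b', hb, rfl, rfl⟩
    exact ⟨⟨_, ha⟩, ⟨_, hb⟩⟩

end EffectivelyEnumerable

/-- The statements derivable by a set of rules; a rule is a pair of a conclusion and a list of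
premises. -/
inductive Derivable {α : Type*} (R : Set (α × List α)) : α → Prop
  | intro {a : α} {ps : List α} (h : (a, ps) ∈ R) (hps : ∀ p ∈ ps, Derivable R p) : Derivable R a

open Classical in
/-- The statements derived after `k` steps, if step `k` tries to apply the rule `e k.unpair.1`. -/
noncomputable def derivationStage {α : Type*} (e : ℕ → Option (α × List α)) : ℕ → List α
  | 0 => []
  | k + 1 => (e k.unpair.1).elim (derivationStage e k) fun r =>
      if ∀ p ∈ r.2, p ∈ derivationStage e k then r.1 :: derivationStage e k
      else derivationStage e k

section

variable {α : Type*} {e : ℕ → Option (α × List α)}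

theorem derivationStage_mono {k m : ℕ} (hkm : k ≤ m) {a : α} (ha : a ∈ derivationStage e k) :
    a ∈ derivationStage e m := by
  induction hkm with
  | refl => exact ha
  | @step m _ ih =>
    rw [derivationStage]
    rcases e m.unpair.1 with _ | r
    · exact ih
    · simp only [Option.elim]
      split_ifs
      · exact List.mem_cons_of_mem _ ih
      · exact ih

/-- Every rule is tried at infinitely many steps, hence also at one that comes after all of its
finitely many premises have been derived. -/
theorem exists_mem_derivationStage {R : Set (α × List α)} (h : ∀ a, a ∈ R ↔ ∃ n, e n = some a)
    {a : α} : (∃ k, a ∈ derivationStage e k) ↔ Derivable R a := by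
  constructor
  · rintro ⟨k, hk⟩
    induction k generalizing a with
    | zero => simp [derivationStage] at hk
    | succ k ih =>
      rw [derivationStage] at hk
      rcases hr : e k.unpair.1 with _ | r
      · rw [hr] at hk; exact ih hk
      · rw [hr] at hk
        simp only [Option.elim] at hk
        split_ifs at hk with hps
        · rcases List.mem_cons.1 hk with rfl | hk
          · exact .intro (ps := r.2) ((h _).2 ⟨_, hr⟩) fun p hp => ih (hps p hp)
          · exact ih hk
        · exact ih hk
  · intro ha
    induction ha with
    | @intro a ps hR _ ih =>
      obtain ⟨n, hn⟩ := (h _).1 hR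
      have : ∃ K, ∀ p ∈ ps, p ∈ derivationStage e K := by
        clear hR hn
        rename_i hps
        clear hps
        induction ps with
        | nil => exact ⟨0, by simp⟩
        | cons q qs ihq =>
          obtain ⟨K, hK⟩ := ihq fun p hp => ih p (by simp [hp])
          obtain ⟨m, hm⟩ := ih q (by simp)
          refine ⟨max K m, fun p hp => ?_⟩
          rcases List.mem_cons.1 hp with rfl | hp
          · exact derivationStage_mono (le_max_right _ _) hm
          · exact derivationStage_mono (le_max_left _ _) (hK p hp)
      obtain ⟨K, hK⟩ := this
      -- Step `Nat.pair n K` tries rule number `n`, and it comes no earlier than stage `K`, which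
      -- contains the premises.
      refine ⟨Nat.pair n K + 1, ?_⟩
      rw [derivationStage, Nat.unpair_pair, hn]
      simp only [Option.elim]
      rw [if_pos fun p hp => derivationStage_mono (Nat.right_le_pair n K) (hK p hp)]
      simp

end

theorem PrimrecRel.mem_list {α : Type*} [Primcodable α] :
    PrimrecRel fun (a : α) (l : List α) => a ∈ l := by
  classical
  have h : PrimrecRel fun (l : List α) (a : α) => ∃ b ∈ l, b = a :=
    PrimrecRel.exists_mem_list Primrec.eq
  have h' : PrimrecRel fun (a : α) (l : List α) => ∃ b ∈ l, b = a :=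
    h.comp₂ Primrec₂.right Primrec₂.left
  exact h'.of_eq fun a l => by simp

theorem Primrec.derivationStage {α : Type*} [Primcodable α] {e : ℕ → Option (α × List α)}
    (he : Primrec e) : Primrec (derivationStage e) := by
  classical
  have hall : PrimrecRel fun (ps : List α) (l : List α) => ∀ p ∈ ps, p ∈ l :=
    PrimrecRel.forall_mem_list PrimrecRel.mem_list
  let step : ℕ → List α → List α := fun k l => (e k.unpair.1).elim l fun r =>
    if ∀ p ∈ r.2, p ∈ l then r.1 :: l else l
  have hstep : Primrec₂ step := by
    have : Primrec₂ fun (x : ℕ × List α) (r : α × List α) =>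
        if ∀ p ∈ r.2, p ∈ x.2 then r.1 :: x.2 else x.2 :=
      Primrec.ite (hall.comp (Primrec.snd.comp Primrec.snd) (Primrec.snd.comp Primrec.fst))
        (Primrec.list_cons.comp (Primrec.fst.comp Primrec.snd) (Primrec.snd.comp Primrec.fst))
        (Primrec.snd.comp Primrec.fst)
    refine (Primrec.option_casesOn (o := fun x : ℕ × List α => e x.1.unpair.1)
      (he.comp (Primrec.fst.comp (Primrec.unpair.comp Primrec.fst))) Primrec.snd this).of_eq ?_
    rintro ⟨k, l⟩
    simp only [step]
    cases e k.unpair.1 <;> rfl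
  refine (Primrec.nat_rec₁ [] hstep).of_eq fun n => ?_
  induction n with
  | zero => rfl
  | succ n ih =>
    simp only [_root_.derivationStage]
    rw [← ih]

/-- The enumeration runs through all pairs of a stage and a position in the list of that stage. -/
theorem EffectivelyEnumerable.derivable {α : Type*} [Primcodable α] {R : Set (α × List α)}
    (hR : EffectivelyEnumerable R) : EffectivelyEnumerable {a | Derivable R a} := by
  obtain ⟨e, he, h⟩ := hR
  refine ⟨fun n => (derivationStage e n.unpair.1)[n.unpair.2]?,
    Primrec.list_getElem?.comp
      ((Primrec.derivationStage he).comp (Primrec.fst.comp Primrec.unpair))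
      (Primrec.snd.comp Primrec.unpair), fun a => ?_⟩
  rw [Set.mem_ofPred_eq, ← exists_mem_derivationStage h]
  constructor
  · rintro ⟨k, hk⟩
    obtain ⟨i, hi⟩ := List.mem_iff_getElem?.1 hk
    exact ⟨Nat.pair k i, by simpa using hi⟩
  · rintro ⟨n, hn⟩
    exact ⟨_, List.mem_iff_getElem?.2 ⟨_, hn⟩⟩

/-- Of two statements, the first one to appear in an enumeration can be found. -/
theorem EffectivelyEnumerable.exists_partrec_race {α β : Type*} [Primcodable α] [Primcodable β]
    {s : Set β} (hs : EffectivelyEnumerable s) {f g : α → β} (hf : Primrec f) (hg : Primrec g) :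
    ∃ D : α →. Bool, Partrec D ∧ ∀ a, (f a ∈ s ∨ g a ∈ s) →
      ∃ b ∈ D a, (b = true → f a ∈ s) ∧ (b = false → g a ∈ s) := by
  classical
  obtain ⟨e, he, h⟩ := hs
  let F : α → ℕ → Option Bool := fun a n =>
    if e n = some (f a) then some true else if e n = some (g a) then some false else none
  have hF : Primrec₂ F :=
    Primrec.ite (Primrec.eq.comp (he.comp Primrec.snd)
        (Primrec.option_some.comp (hf.comp Primrec.fst))) (Primrec.const _)
      (Primrec.ite (Primrec.eq.comp (he.comp Primrec.snd)
        (Primrec.option_some.comp (hg.comp Primrec.fst))) (Primrec.const _) (Primrec.const _))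
  refine ⟨fun a => Nat.rfindOpt (F a), Partrec.rfindOpt hF.to_comp, fun a ha => ?_⟩
  have hdom : (Nat.rfindOpt (F a)).Dom := by
    rw [Nat.rfindOpt_dom]
    rw [h, h] at ha
    rcases ha with ⟨n, hn⟩ | ⟨n, hn⟩
    · exact ⟨n, true, by simp [F, hn]⟩
    -- If the two statements coincide, the first test succeeds and the answer is `true`, which is
    -- correct as well.
    · by_cases hfg : f a = g a
      · exact ⟨n, true, by simp [F, hn, hfg]⟩
      · exact ⟨n, false, by simp [F, hn, Ne.symm hfg]⟩
  refine ⟨_, Part.get_mem hdom, ?_⟩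
  obtain ⟨n, hn⟩ := Nat.rfindOpt_spec (Part.get_mem hdom)
  generalize (Nat.rfindOpt (F a)).get hdom = b at hn
  simp only [F, Option.mem_def] at hn
  rw [h, h]
  split_ifs at hn with h1 h2 <;> cases hn
  · exact ⟨fun _ => ⟨n, h1⟩, nofun⟩
  · exact ⟨nofun, fun _ => ⟨n, h2⟩⟩

/-! ### Machines with finite oracles -/

namespace OracleCode

/-- The judgment `(c, p, n, y)` says that the program with Gödel number `c` yields `y` on input `n`
with every oracle whose first answers are the entries of `p`. Moreover, `(⟨9, c⟩, p, ⟨a, m⟩, 0)`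
says that `c` yields positive numbers on the inputs `⟨a, j⟩` with `j < m`. -/
abbrev Judgment : Type := ℕ × List ℕ × ℕ × ℕ

/-- The derivation rules for runs with finite oracles. -/
def runRules : Set (Judgment × List Judgment) :=
  Set.range (fun (p, n) => ((Nat.pair 0 0, p, n, 0), []) : List ℕ × ℕ → _) ∪
  Set.range (fun (p, n) => ((Nat.pair 1 0, p, n, n + 1), []) : List ℕ × ℕ → _) ∪
  Set.range (fun (p, a, b) => ((Nat.pair 2 0, p, Nat.pair a b, a), []) : List ℕ × ℕ × ℕ → _) ∪
  Set.range (fun (p, a, b) => ((Nat.pair 3 0, p, Nat.pair a b, b), []) : List ℕ × ℕ × ℕ → _) ∪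
  Set.range (fun (p, y, q) => ((Nat.pair 4 0, p ++ y :: q, p.length, y), []) :
    List ℕ × ℕ × List ℕ → _) ∪
  Set.range (fun (c, d, p, n, a, b) =>
    ((Nat.pair 5 (Nat.pair c d), p, n, Nat.pair a b), [(c, p, n, a), (d, p, n, b)]) :
    ℕ × ℕ × List ℕ × ℕ × ℕ × ℕ → _) ∪
  Set.range (fun (c, d, p, n, a, b) =>
    ((Nat.pair 6 (Nat.pair c d), p, n, b), [(d, p, n, a), (c, p, a, b)]) :
    ℕ × ℕ × List ℕ × ℕ × ℕ × ℕ → _) ∪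
  Set.range (fun (c, d, p, a, y) =>
    ((Nat.pair 7 (Nat.pair c d), p, Nat.pair a 0, y), [(c, p, a, y)]) :
    ℕ × ℕ × List ℕ × ℕ × ℕ → _) ∪
  Set.range (fun (c, d, p, a, m, i, y) =>
    ((Nat.pair 7 (Nat.pair c d), p, Nat.pair a (m + 1), y),
      [(Nat.pair 7 (Nat.pair c d), p, Nat.pair a m, i),
        (d, p, Nat.pair a (Nat.pair m i), y)]) :
    ℕ × ℕ × List ℕ × ℕ × ℕ × ℕ × ℕ → _) ∪
  Set.range (fun (c, p, a, m) =>
    ((Nat.pair 8 c, p, a, m), [(Nat.pair 9 c, p, Nat.pair a m, 0), (c, p, Nat.pair a m, 0)]) :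
    ℕ × List ℕ × ℕ × ℕ → _) ∪
  Set.range (fun (c, p, a) => ((Nat.pair 9 c, p, Nat.pair a 0, 0), []) : ℕ × List ℕ × ℕ → _) ∪
  Set.range (fun (c, p, a, m, v) => ((Nat.pair 9 c, p, Nat.pair a (m + 1), 0),
      [(Nat.pair 9 c, p, Nat.pair a m, 0), (c, p, Nat.pair a m, v + 1)]) :
    ℕ × List ℕ × ℕ × ℕ × ℕ → _)

theorem effectivelyEnumerable_runRules : EffectivelyEnumerable runRules := by
  unfold runRules
  repeat' apply EffectivelyEnumerable.union
  all_goals exact EffectivelyEnumerable.range (by fun_prop)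

/-- Runs of the program number `c` with the finite oracle `p`. -/
def Runs (c : ℕ) (p : List ℕ) (n y : ℕ) : Prop := Derivable runRules (c, p, n, y)

theorem effectivelyEnumerable_runs :
    EffectivelyEnumerable {j : Judgment | Runs j.1 j.2.1 j.2.2.1 j.2.2.2} :=
  effectivelyEnumerable_runRules.derivable

/-- With oracle `O`, the program `c` yields `y` on input `n`. -/
def Yields (O : ℕ → ℕ) (c : OracleCode) (n y : ℕ) : Prop := y ∈ eval O c n

section Yields

variable {O : ℕ → ℕ} {c d : OracleCode} {n y a m : ℕ}

theorem yields_zero : Yields O zero n y ↔ y = 0 := Part.mem_some_iff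

theorem yields_succ : Yields O succ n y ↔ y = n + 1 := Part.mem_some_iff

theorem yields_left : Yields O left n y ↔ y = n.unpair.1 := Part.mem_some_iff

theorem yields_right : Yields O right n y ↔ y = n.unpair.2 := Part.mem_some_iff

theorem yields_oracle : Yields O oracle n y ↔ y = O n := Part.mem_some_iff

theorem yields_pair :
    Yields O (pair c d) n y ↔ ∃ a, Yields O c n a ∧ ∃ b, Yields O d n b ∧ Nat.pair a b = y := by
  refine Part.mem_bind_iff.trans (exists_congr fun a => and_congr_right fun _ => ?_)
  exact Part.mem_map_iff _

theorem yields_comp : Yields O (comp c d) n y ↔ ∃ a, Yields O d n a ∧ Yields O c a y :=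
  Part.mem_bind_iff

theorem yields_prec_zero : Yields O (prec c d) (Nat.pair a 0) y ↔ Yields O c a y := by
  have : eval O (prec c d) (Nat.pair a 0) = eval O c a := by
    simp only [eval, Nat.unpair_pair, Nat.rec_zero]
  rw [Yields, this, Yields]

theorem yields_prec_succ : Yields O (prec c d) (Nat.pair a (m + 1)) y ↔
    ∃ i, Yields O (prec c d) (Nat.pair a m) i ∧ Yields O d (Nat.pair a (Nat.pair m i)) y := by
  have : eval O (prec c d) (Nat.pair a (m + 1)) = (eval O (prec c d) (Nat.pair a m)).bind fun i =>
      eval O d (Nat.pair a (Nat.pair m i)) := by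
    simp only [eval, Nat.unpair_pair]
  rw [Yields, this]
  exact Part.mem_bind_iff

theorem yields_rfind : Yields O (rfind c) a m ↔
    Yields O c (Nat.pair a m) 0 ∧ ∀ i < m, ∃ v, Yields O c (Nat.pair a i) (v + 1) := by
  refine Nat.mem_rfind.trans (and_congr ?_ (forall₂_congr fun j _ => ?_))
  · refine (Part.mem_map_iff _).trans ?_
    simp only [decide_eq_true_eq, exists_eq_right]
    rfl
  · refine (Part.mem_map_iff _).trans ?_
    simp only [decide_eq_false_iff_not]
    constructor
    · rintro ⟨v, hv, hv0⟩
      obtain ⟨w, rfl⟩ := Nat.exists_eq_succ_of_ne_zero hv0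
      exact ⟨w, hv⟩
    · rintro ⟨v, hv⟩
      exact ⟨_, hv, Nat.succ_ne_zero v⟩

end Yields

/-- The meaning of a judgment about runs. -/
structure Judgment.Holds (O : ℕ → ℕ) (n : ℕ) (k y : ℕ) : Prop where
  yields : ∀ c : OracleCode, n = c.toNat → Yields O c k y
  below : ∀ (c : OracleCode) (a m : ℕ), n = Nat.pair 9 c.toNat → k = Nat.pair a m →
    ∀ i < m, ∃ v, Yields O c (Nat.pair a i) (v + 1)

/-- Each rule mirrors one clause of `eval`. An oracle rule reads only entries of the list, and there
`O` agrees with it. -/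
theorem Judgment.holds_of_derivable {O : ℕ → ℕ} {j : Judgment} (hj : Derivable runRules j)
    (hO : ∀ i (h : i < j.2.1.length), j.2.1[i] = O i) :
    Judgment.Holds O j.1 j.2.2.1 j.2.2.2 := by
  induction hj with
  | @intro j ps h _ ih =>
    rcases h with ((((((((((⟨⟨p, n⟩, h⟩ | ⟨⟨p, n⟩, h⟩) | ⟨⟨p, a, b⟩, h⟩) | ⟨⟨p, a, b⟩, h⟩) |
      ⟨⟨p, y, q⟩, h⟩) | ⟨⟨c, d, p, n, a, b⟩, h⟩) | ⟨⟨c, d, p, n, a, b⟩, h⟩) |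
      ⟨⟨c, d, p, a, y⟩, h⟩) | ⟨⟨c, d, p, a, m, i, y⟩, h⟩) | ⟨⟨c, p, a, m⟩, h⟩) |
      ⟨⟨c, p, a⟩, h⟩) | ⟨⟨c, p, a, m, v⟩, h⟩ <;>
    (cases h; simp only [List.forall_mem_cons, List.not_mem_nil, false_imp_iff, implies_true,
      and_true] at ih hO ⊢)
    -- The last two rules concern the tag 9, which no program has, so only `below` has content for
    -- them. For all other rules it is only `yields`.
    pick_goal 12
    · refine ⟨fun e he => by cases e <;> simp [toNat, Nat.pair_eq_pair] at he,
        fun e a' m' he hn k hk => ?_⟩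
      rw [Nat.pair_eq_pair] at hn he
      obtain ⟨rfl, rfl⟩ := hn
      rcases Nat.lt_succ_iff_lt_or_eq.1 hk with hk | rfl
      · exact (ih.1 hO).below e a m (by rw [he.2]) rfl k hk
      · exact ⟨v, (ih.2 hO).yields e he.2⟩
    pick_goal 11
    · refine ⟨fun e he => by cases e <;> simp [toNat, Nat.pair_eq_pair] at he,
        fun e a' m' he hn k hk => ?_⟩
      rw [Nat.pair_eq_pair] at hn
      exact absurd (hn.2 ▸ hk) (Nat.not_lt_zero _)
    all_goals
      refine ⟨fun e he => ?_, fun e a' m' he => by simp [Nat.pair_eq_pair] at he⟩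
      cases e <;> simp [toNat, Nat.pair_eq_pair] at he
    · exact yields_zero.2 rfl
    · exact yields_succ.2 rfl
    · exact yields_left.2 (by simp)
    · exact yields_right.2 (by simp)
    · have := hO p.length (by simp)
      simp only [List.getElem_append_right, le_refl, Nat.sub_self, List.getElem_cons_zero] at this
      exact yields_oracle.2 this
    · exact yields_pair.2 ⟨a, (ih.1 hO).yields _ he.1, b, (ih.2 hO).yields _ he.2, rfl⟩
    · exact yields_comp.2 ⟨a, (ih.1 hO).yields _ he.2, (ih.2 hO).yields _ he.1⟩
    · exact yields_prec_zero.2 ((ih hO).yields _ he.1)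
    · exact yields_prec_succ.2
        ⟨i, (ih.1 hO).yields _ (by rw [toNat, he.1, he.2]), (ih.2 hO).yields _ he.2⟩
    · exact yields_rfind.2 ⟨(ih.2 hO).yields _ he, (ih.1 hO).below _ a m (by rw [he]) rfl⟩

theorem Runs.yields {O : ℕ → ℕ} {c : OracleCode} {p : List ℕ} {n y : ℕ}
    (h : Runs c.toNat p n y) (hO : ∀ i (h : i < p.length), p[i] = O i) : Yields O c n y :=
  (Judgment.holds_of_derivable h hO).yields c rfl

section Rules

variable {c d n a b y m i v : ℕ} {p q : List ℕ}

theorem Runs.zero : Runs (Nat.pair 0 0) p n 0 :=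
  .intro (ps := []) (by iterate 11 left
                        exact ⟨(p, n), rfl⟩) (by simp)

theorem Runs.succ : Runs (Nat.pair 1 0) p n (n + 1) :=
  .intro (ps := []) (by iterate 10 left
                        exact .inr ⟨(p, n), rfl⟩) (by simp)

theorem Runs.left : Runs (Nat.pair 2 0) p (Nat.pair a b) a :=
  .intro (ps := []) (by iterate 9 left
                        exact .inr ⟨(p, a, b), rfl⟩) (by simp)

theorem Runs.right : Runs (Nat.pair 3 0) p (Nat.pair a b) b :=
  .intro (ps := []) (by iterate 8 left
                        exact .inr ⟨(p, a, b), rfl⟩) (by simp)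

theorem Runs.oracle : Runs (Nat.pair 4 0) (p ++ y :: q) p.length y :=
  .intro (ps := []) (by iterate 7 left
                        exact .inr ⟨(p, y, q), rfl⟩) (by simp)

theorem Runs.pair (h₁ : Runs c p n a) (h₂ : Runs d p n b) :
    Runs (Nat.pair 5 (Nat.pair c d)) p n (Nat.pair a b) :=
  .intro (by iterate 6 left
             exact .inr ⟨(c, d, p, n, a, b), rfl⟩)
    (by simpa only [List.forall_mem_cons] using ⟨h₁, h₂, by simp⟩)

theorem Runs.comp (h₁ : Runs d p n a) (h₂ : Runs c p a b) :
    Runs (Nat.pair 6 (Nat.pair c d)) p n b :=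
  .intro (by iterate 5 left
             exact .inr ⟨(c, d, p, n, a, b), rfl⟩)
    (by simpa only [List.forall_mem_cons] using ⟨h₁, h₂, by simp⟩)

theorem Runs.prec_zero (h : Runs c p a y) :
    Runs (Nat.pair 7 (Nat.pair c d)) p (Nat.pair a 0) y :=
  .intro (by iterate 4 left
             exact .inr ⟨(c, d, p, a, y), rfl⟩)
    (by simpa only [List.forall_mem_cons] using ⟨h, by simp⟩)

theorem Runs.prec_succ (h₁ : Runs (Nat.pair 7 (Nat.pair c d)) p (Nat.pair a m) i)
    (h₂ : Runs d p (Nat.pair a (Nat.pair m i)) y) :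
    Runs (Nat.pair 7 (Nat.pair c d)) p (Nat.pair a (m + 1)) y :=
  .intro (by iterate 3 left
             exact .inr ⟨(c, d, p, a, m, i, y), rfl⟩)
    (by simpa only [List.forall_mem_cons] using ⟨h₁, h₂, by simp⟩)

theorem Runs.rfind (h₁ : Runs (Nat.pair 9 c) p (Nat.pair a m) 0)
    (h₂ : Runs c p (Nat.pair a m) 0) : Runs (Nat.pair 8 c) p a m :=
  .intro (by iterate 2 left
             exact .inr ⟨(c, p, a, m), rfl⟩)
    (by simpa only [List.forall_mem_cons] using ⟨h₁, h₂, by simp⟩)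

theorem Runs.below_zero : Runs (Nat.pair 9 c) p (Nat.pair a 0) 0 :=
  .intro (ps := []) (.inl (.inr ⟨(c, p, a), rfl⟩)) (by simp)

theorem Runs.below_succ (h₁ : Runs (Nat.pair 9 c) p (Nat.pair a m) 0)
    (h₂ : Runs c p (Nat.pair a m) (v + 1)) : Runs (Nat.pair 9 c) p (Nat.pair a (m + 1)) 0 :=
  .intro (.inr ⟨(c, p, a, m, v), rfl⟩)
    (by simpa only [List.forall_mem_cons] using ⟨h₁, h₂, by simp⟩)

end Rules

open Filter in
/-- A run of a machine uses only finitely many answers of the oracle. -/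
theorem Yields.eventually_runs {O : ℕ → ℕ} {c : OracleCode} {n y : ℕ} (h : Yields O c n y) :
    ∀ᶠ k in atTop, Runs c.toNat ((List.range k).map O) n y := by
  induction c generalizing n y with
  | zero => rw [yields_zero.1 h]; exact .of_forall fun _ => Runs.zero
  | succ => rw [yields_succ.1 h]; exact .of_forall fun _ => Runs.succ
  | left =>
    rw [yields_left.1 h, ← Nat.pair_unpair n, Nat.unpair_pair]
    exact .of_forall fun _ => Runs.left
  | right =>
    rw [yields_right.1 h, ← Nat.pair_unpair n, Nat.unpair_pair]
    exact .of_forall fun _ => Runs.right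
  | oracle =>
    rw [yields_oracle.1 h]
    -- The answer to query `n` is recorded as soon as the list has at least `n + 1` entries.
    filter_upwards [eventually_ge_atTop (n + 1)] with k hk
    obtain ⟨m, rfl⟩ := Nat.exists_eq_add_of_le hk
    rw [add_assoc, List.range_add, List.map_append, Nat.add_comm 1 m, List.range_succ_eq_map]
    rw [List.map_cons, List.map_cons]
    simpa [toNat] using
      Runs.oracle (p := (List.range n).map O) (y := O n)
        (q := (((List.range m).map Nat.succ).map fun x => n + x).map O)
  | pair c d ihc ihd =>
    obtain ⟨a, ha, b, hb, rfl⟩ := yields_pair.1 h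
    filter_upwards [ihc ha, ihd hb] with k h₁ h₂ using h₁.pair h₂
  | comp c d ihc ihd =>
    obtain ⟨a, ha, hb⟩ := yields_comp.1 h
    filter_upwards [ihd ha, ihc hb] with k h₁ h₂ using h₁.comp h₂
  | prec c d ihc ihd =>
    obtain ⟨a, m, rfl⟩ : ∃ a m, n = Nat.pair a m := ⟨_, _, (Nat.pair_unpair n).symm⟩
    induction m generalizing y with
    | zero =>
      filter_upwards [ihc (yields_prec_zero.1 h)] with k hk using hk.prec_zero
    | succ m ih =>
      obtain ⟨i, hi, hy⟩ := yields_prec_succ.1 h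
      filter_upwards [ih hi, ihd hy] with k h₁ h₂ using h₁.prec_succ h₂
  | rfind c ih =>
    obtain ⟨h0, hlt⟩ := yields_rfind.1 h
    -- The unbounded search has made only `y` unsuccessful trials, so finitely many "eventually"
    -- statements are intersected, one per trial.
    have : ∀ m ≤ y, ∀ᶠ k in atTop,
        Runs (Nat.pair 9 c.toNat) ((List.range k).map O) (Nat.pair n m) 0 := by
      intro m
      induction m with
      | zero => exact fun _ => .of_forall fun _ => Runs.below_zero
      | succ m ihm =>
        intro hm
        obtain ⟨v, hv⟩ := hlt m hm
        filter_upwards [ihm (Nat.le_of_succ_le hm), ih hv] with k h₁ h₂ using h₁.below_succ h₂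
    filter_upwards [this y le_rfl, ih h0] with k h₁ h₂ using h₁.rfind h₂

end OracleCode

/-! ### Approximation of terms on boxes -/

theorem exists_dyadic_near (r : ℝ) (i : ℕ) : ∃ z : ℤ, |dyadicVal (z, i) - r| < (2 : ℝ)⁻¹ ^ i := by
  have h2 : (0 : ℝ) < 2 ^ i := by positivity
  refine ⟨⌊r * 2 ^ i⌋, ?_⟩
  have h1 := Int.floor_le (r * 2 ^ i)
  have h3 := Int.lt_floor_add_one (r * 2 ^ i)
  have : dyadicVal (⌊r * 2 ^ i⌋, i) - r = (⌊r * 2 ^ i⌋ - r * 2 ^ i) / 2 ^ i := by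
    rw [dyadicVal]; field_simp
  rw [this, abs_div, abs_of_pos h2, inv_pow, ← one_div]
  gcongr
  rw [abs_lt]
  constructor <;> linarith

open Filter in
theorem eventually_inv_two_pow_lt {ε : ℝ} (hε : 0 < ε) : ∀ᶠ N : ℕ in atTop, (2 : ℝ)⁻¹ ^ N < ε :=
  (tendsto_pow_atTop_nhds_zero_of_lt_one (by norm_num) (by norm_num)).eventually_lt_const hε

theorem inv_two_pow_pos (i : ℕ) : (0 : ℝ) < 2⁻¹ ^ i := by positivity

/-- The ball of radius `2⁻ᵐ` around `d` is contained in the ball of radius `2⁻ⁱ` around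
`z / 2 ^ i`. -/
def Refines (d : ℤ × ℕ) (m : ℕ) (z : ℤ) (i : ℕ) : Prop :=
  |dyadicVal d - dyadicVal (z, i)| + (2 : ℝ)⁻¹ ^ m ≤ (2 : ℝ)⁻¹ ^ i

/-- Multiplication by `2 ^ (k + m + i)` clears all denominators, and the absolute value splits into
two inequalities. Moving negative terms across leaves comparisons of natural numbers, which are
primitive recursive. -/
theorem refines_subNatNat_iff {a b k m p q i : ℕ} :
    Refines (Int.subNatNat a b, k) m (Int.subNatNat p q) i ↔
      a * 2 ^ (m + i) + q * 2 ^ (k + m) + 2 ^ (k + i) ≤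
          p * 2 ^ (k + m) + b * 2 ^ (m + i) + 2 ^ (k + m) ∧
        p * 2 ^ (k + m) + b * 2 ^ (m + i) + 2 ^ (k + i) ≤
          a * 2 ^ (m + i) + q * 2 ^ (k + m) + 2 ^ (k + m) := by
  have hpos : (0 : ℝ) < 2 ^ (k + m + i) := by positivity
  have e1 : ((2 : ℝ) ^ (k + m + i)) * (dyadicVal (Int.subNatNat a b, k) -
      dyadicVal (Int.subNatNat p q, i)) =
      (a - b) * 2 ^ (m + i) - (p - q) * 2 ^ (k + m) := by
    simp only [dyadicVal, Int.subNatNat_eq_coe, pow_add]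
    push_cast
    field_simp
  have abs_mul_left : ∀ {c x : ℝ}, 0 < c → |c * x| = c * |x| := fun hc => by
    rw [abs_mul, abs_of_pos hc]
  have e2 : ((2 : ℝ) ^ (k + m + i)) * 2⁻¹ ^ m = 2 ^ (k + i) := by
    rw [inv_pow, pow_add, pow_add, pow_add]; field_simp
  have e3 : ((2 : ℝ) ^ (k + m + i)) * 2⁻¹ ^ i = 2 ^ (k + m) := by
    rw [inv_pow, pow_add, pow_add]; field_simp
  rw [Refines, ← mul_le_mul_iff_right₀ hpos, mul_add, e2, e3, ← abs_mul_left hpos, e1, ← le_sub_iff_add_le, abs_le]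
  rify
  constructor <;> rintro ⟨h1, h2⟩ <;> constructor <;> linarith

theorem effectivelyEnumerable_refines :
    EffectivelyEnumerable {r : (ℤ × ℕ) × ℕ × ℤ × ℕ | Refines r.1 r.2.1 r.2.2.1 r.2.2.2} := by
  have hp : PrimrecPred fun x : ((ℕ × ℕ) × ℕ) × ℕ × (ℕ × ℕ) × ℕ =>
      x.1.1.1 * 2 ^ (x.2.1 + x.2.2.2) + x.2.2.1.2 * 2 ^ (x.1.2 + x.2.1) + 2 ^ (x.1.2 + x.2.2.2) ≤
          x.2.2.1.1 * 2 ^ (x.1.2 + x.2.1) + x.1.1.2 * 2 ^ (x.2.1 + x.2.2.2) +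
            2 ^ (x.1.2 + x.2.1) ∧
        x.2.2.1.1 * 2 ^ (x.1.2 + x.2.1) + x.1.1.2 * 2 ^ (x.2.1 + x.2.2.2) +
            2 ^ (x.1.2 + x.2.2.2) ≤
          x.1.1.1 * 2 ^ (x.2.1 + x.2.2.2) + x.2.2.1.2 * 2 ^ (x.1.2 + x.2.1) +
            2 ^ (x.1.2 + x.2.1) :=
    PrimrecPred.and (Primrec.nat_le.comp (by fun_prop) (by fun_prop))
      (Primrec.nat_le.comp (by fun_prop) (by fun_prop))
  have hf : Primrec fun x : ((ℕ × ℕ) × ℕ) × ℕ × (ℕ × ℕ) × ℕ =>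
      ((Int.subNatNat x.1.1.1 x.1.1.2, x.1.2), x.2.1,
        Int.subNatNat x.2.2.1.1 x.2.2.1.2, x.2.2.2) := by fun_prop
  have hint : ∀ z : ℤ, ∃ p q, z = Int.subNatNat p q := fun z =>
    ⟨z.toNat, (-z).toNat, by rw [Int.subNatNat_eq_coe]; omega⟩
  convert (EffectivelyEnumerable.univ.sep hp).image hf using 1
  ext ⟨⟨a, k⟩, m, z, i⟩
  obtain ⟨a, b, rfl⟩ := hint a
  obtain ⟨p, q, rfl⟩ := hint z
  constructor
  · intro h
    exact ⟨(((a, b), k), m, (p, q), i), ⟨trivial, refines_subNatNat_iff.1 h⟩, rfl⟩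
  · rintro ⟨⟨⟨⟨a', b'⟩, k'⟩, m', ⟨p', q'⟩, i'⟩, ⟨-, h⟩, e⟩
    rw [← e]
    exact refines_subNatNat_iff.2 h

theorem List.forall₂_ofFn_iff {α β : Type*} {R : α → β → Prop} {n : ℕ} {f : Fin n → α}
    {g : Fin n → β} : List.Forall₂ R (List.ofFn f) (List.ofFn g) ↔ ∀ i, R (f i) (g i) := by
  induction n with
  | zero => simp
  | succ n ih => simp [List.ofFn_succ, ih, Fin.forall_fin_succ]

theorem List.Forall₂.exists_ofFn_left {α β : Type*} {R : α → β → Prop} {n : ℕ} {l : List α}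
    {g : Fin n → β} (h : List.Forall₂ R l (List.ofFn g)) :
    ∃ f : Fin n → α, l = List.ofFn f ∧ ∀ i, R (f i) (g i) := by
  have hl : l.length = n := by simpa using h.length_eq
  subst hl
  refine ⟨l.get, (List.ofFn_get l).symm, ?_⟩
  rw [← List.forall₂_ofFn_iff, List.ofFn_get]
  exact h

/-- Passing under a quantifier appends a ball to the box and, in parallel, a coordinate to the point
by `Fin.snoc`. -/
theorem List.Forall₂.append_singleton {α β : Type*} {R : α → β → Prop} {l : List α} {n : ℕ}
    {x : Fin n → β} (h : List.Forall₂ R l (List.ofFn x)) {a : α} {b : β} (hab : R a b) :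
    List.Forall₂ R (l ++ [a]) (List.ofFn (Fin.snoc x b : Fin (n + 1) → β)) := by
  rw [List.ofFn_succ', List.concat_eq_append]
  simp only [Fin.snoc_castSucc, Fin.snoc_last]
  exact List.rel_append h (.cons hab .nil)

namespace RealLogic

/-- A box is a product of balls with dyadic centres; `(d, m)` stands for the ball of radius `2⁻ᵐ`
around `d`. -/
abbrev Box : Type := List ((ℤ × ℕ) × ℕ)

/-- The point `x` lies in the box. -/
def Box.Contains (b : Box) {n : ℕ} (x : Fin n → ℝ) : Prop :=
  List.Forall₂ (fun e y => |dyadicVal e.1 - y| < (2 : ℝ)⁻¹ ^ e.2) b (List.ofFn x)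

/-- The box is contained in the cube of half-width `2⁻ᴺ` around `x`. -/
def Box.Near (b : Box) (N : ℕ) {n : ℕ} (x : Fin n → ℝ) : Prop :=
  List.Forall₂ (fun e y => |dyadicVal e.1 - y| + (2 : ℝ)⁻¹ ^ e.2 ≤ (2 : ℝ)⁻¹ ^ N) b (List.ofFn x)

/-- Judgments about terms: the number `t` of a term, a box, `i` and `z`, which says that the term
has values within `2⁻ⁱ` of `z / 2 ^ i` on the box; the number `ts` of a list of terms, a box, `i`
and the code of a list of `i`-th approximations to the terms, valid on the box; and `ts`, a box
and a list whose `i`-th entry is such a code for every `i`. -/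
abbrev TermJudgment : Type :=
  (ℕ × Box × ℕ × ℤ) ⊕ (ℕ × Box × ℕ × ℕ) ⊕ (ℕ × Box × List ℕ)

/-- The derivation rules for approximations of terms. -/
def termRules : Set (TermJudgment × List TermJudgment) :=
  (fun (r, l, l') => (.inl (Nat.pair 0 l.length, l ++ (r.1, r.2.1) :: l', r.2.2.2, r.2.2.1), []) :
      ((ℤ × ℕ) × ℕ × ℤ × ℕ) × Box × Box → _) ''
    ({r | Refines r.1 r.2.1 r.2.2.1 r.2.2.2} ×ˢ Set.univ) ∪
  (fun x => (.inl (Nat.pair 1 (Nat.pair x.1.2.1 x.2.1), x.2.2, x.1.1.2.2.2, x.1.1.2.2.1),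
      [.inr (.inr (x.2.1, x.2.2, x.1.2.2.1))]) :
      (((ℤ × ℕ) × ℕ × ℤ × ℕ) × OracleCode.Judgment) × ℕ × Box → _) ''
    {x ∈ ({r | Refines r.1 r.2.1 r.2.2.1 r.2.2.2} ×ˢ
      {j | OracleCode.Runs j.1 j.2.1 j.2.2.1 j.2.2.2}) ×ˢ Set.univ |
      x.1.2.2.2.1 = x.1.1.2.1 ∧ x.1.2.2.2.2 = Encodable.encode x.1.1.1} ∪
  Set.range (fun (b, i) => (.inr (.inl (0, b, i, 0)), []) : Box × ℕ → _) ∪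
  Set.range (fun (t, ts, b, i, z, ys) =>
    (.inr (.inl (Nat.pair t ts + 1, b, i, Nat.pair (Encodable.encode ((z, i) : ℤ × ℕ)) ys + 1)),
      [.inl (t, b, i, z), .inr (.inl (ts, b, i, ys))]) : ℕ × ℕ × Box × ℕ × ℤ × ℕ → _) ∪
  Set.range (fun (ts, b) => (.inr (.inr (ts, b, [])), []) : ℕ × Box → _) ∪
  Set.range (fun (ts, b, p, y) => (.inr (.inr (ts, b, p ++ [y])),
    [.inr (.inr (ts, b, p)), .inr (.inl (ts, b, p.length, y))]) : ℕ × Box × List ℕ × ℕ → _)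

theorem effectivelyEnumerable_termRules : EffectivelyEnumerable termRules := by
  unfold termRules
  repeat' apply EffectivelyEnumerable.union
  · exact (effectivelyEnumerable_refines.prod .univ).image (by fun_prop)
  · refine (((effectivelyEnumerable_refines.prod
      OracleCode.effectivelyEnumerable_runs).prod .univ).sep ?_).image (by fun_prop)
    exact PrimrecPred.and (Primrec.eq.comp (by fun_prop) (by fun_prop))
      (Primrec.eq.comp (by fun_prop) (by fun_prop))
  all_goals exact EffectivelyEnumerable.range (by fun_prop)

/-- On the box `b`, the term with number `t` is derivably within `2⁻ⁱ` of `z / 2 ^ i`. -/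
def TermApprox (t : ℕ) (b : Box) (i : ℕ) (z : ℤ) : Prop :=
  Derivable termRules (.inl (t, b, i, z))

/-- `y` derivably codes a list of `i`-th approximations to the terms of the list `ts`. -/
def ListApprox (ts : ℕ) (b : Box) (i y : ℕ) : Prop :=
  Derivable termRules (.inr (.inl (ts, b, i, y)))

/-- `p` is derivably an initial segment of names for the terms of the list `ts`. -/
def PrefixApprox (ts : ℕ) (b : Box) (p : List ℕ) : Prop :=
  Derivable termRules (.inr (.inr (ts, b, p)))

theorem effectivelyEnumerable_derivable_termRules :
    EffectivelyEnumerable {j : TermJudgment | Derivable termRules j} :=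
  effectivelyEnumerable_termRules.derivable

section Rules

variable {b b' : Box} {d : ℤ × ℕ} {m i c t ts y ys : ℕ} {z : ℤ} {p : List ℕ}

theorem TermApprox.var (h : Refines d m z i) :
    TermApprox (Nat.pair 0 b.length) (b ++ (d, m) :: b') i z :=
  .intro (ps := []) (by iterate 5 left
                        exact ⟨((d, m, z, i), b, b'), ⟨h, trivial⟩, rfl⟩) (by simp)

/-- The machine may be run at any precision `m`; its output `d` is then rounded to a numerator over
`2 ^ i`. The finite oracle `p` consists of certified approximations to the arguments. -/
theorem TermApprox.func (h : Refines d m z i) (hr : OracleCode.Runs c p m (Encodable.encode d))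
    (hp : PrefixApprox ts b p) : TermApprox (Nat.pair 1 (Nat.pair c ts)) b i z :=
  .intro (by iterate 4 left
             exact .inr ⟨(((d, m, z, i), c, p, m, Encodable.encode d), ts, b),
               ⟨⟨⟨h, hr⟩, trivial⟩, rfl, rfl⟩, rfl⟩)
    (by simpa only [List.forall_mem_cons] using ⟨hp, by simp⟩)

theorem ListApprox.nil : ListApprox 0 b i 0 :=
  .intro (ps := []) (by iterate 3 left
                        exact .inr ⟨(b, i), rfl⟩) (by simp)

theorem ListApprox.cons (h : TermApprox t b i z) (hs : ListApprox ts b i ys) :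
    ListApprox (Nat.pair t ts + 1) b i (Nat.pair (Encodable.encode ((z, i) : ℤ × ℕ)) ys + 1) :=
  .intro (by iterate 2 left
             exact .inr ⟨(t, ts, b, i, z, ys), rfl⟩)
    (by simpa only [List.forall_mem_cons] using ⟨h, hs, by simp⟩)

theorem PrefixApprox.nil : PrefixApprox ts b [] :=
  .intro (ps := []) (.inl (.inr ⟨(ts, b), rfl⟩)) (by simp)

theorem PrefixApprox.snoc (hp : PrefixApprox ts b p) (h : ListApprox ts b p.length y) :
    PrefixApprox ts b (p ++ [y]) :=
  .intro (.inr ⟨(ts, b, p, y), rfl⟩)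
    (by simpa only [List.forall_mem_cons] using ⟨hp, h, by simp⟩)

end Rules

section

variable {L : FirstOrder.Language.{u, v}} {M : ∀ k, L.Functions k → OracleCode} {n : ℕ}

theorem encode_ofFn_termCode {l : ℕ} (σ : Fin l → L.Term (Fin n)) :
    Encodable.encode (List.ofFn fun i => termCode M (σ i)) =
      Encodable.encode ((List.ofFn σ).map (termCode M)) := by
  rw [List.map_ofFn]; rfl

theorem ListApprox.of_forall₂ {b : Box} {i : ℕ} {zs : List ℤ} {τs : List (L.Term (Fin n))}
    (h : List.Forall₂ (fun z τ => TermApprox (termCode M τ) b i z) zs τs) :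
    ListApprox (Encodable.encode (τs.map (termCode M))) b i
      (Encodable.encode (zs.map fun z => ((z, i) : ℤ × ℕ))) := by
  induction h with
  | nil => simpa using ListApprox.nil
  | cons h _ ih => simpa [Encodable.encode_list_cons] using ListApprox.cons h ih

end

/-! ### Soundness of the calculus for terms -/

section Soundness

variable {L : FirstOrder.Language.{u, v}} [L.Structure ℝ] {M : ∀ k, L.Functions k → OracleCode}
  {n : ℕ}

/-- `ds` is a list of `i`-th approximations to the values of the terms `τs` at `x`. -/
def ApproximatesList (x : Fin n → ℝ) (i : ℕ) (ds : List (ℤ × ℕ))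
    (τs : List (L.Term (Fin n))) : Prop :=
  List.Forall₂ (fun d τ => |dyadicVal d - τ.realize x| < (2 : ℝ)⁻¹ ^ i) ds τs

/-- Truth of a judgment about terms at a point of its box. -/
def TermJudgment.Holds (M : ∀ k, L.Functions k → OracleCode) (x : Fin n → ℝ) :
    TermJudgment → Prop
  | .inl (t, b, i, z) => b.Contains x → ∀ τ : L.Term (Fin n), t = termCode M τ →
      |dyadicVal (z, i) - τ.realize x| < (2 : ℝ)⁻¹ ^ i
  | .inr (.inl (ts, b, i, y)) => b.Contains x → ∀ τs : List (L.Term (Fin n)),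
      ts = Encodable.encode (τs.map (termCode M)) →
        ∃ ds, y = Encodable.encode ds ∧ ApproximatesList x i ds τs
  | .inr (.inr (ts, b, p)) => b.Contains x → ∀ τs : List (L.Term (Fin n)),
      ts = Encodable.encode (τs.map (termCode M)) →
        ∀ i (h : i < p.length), ∃ ds, p[i] = Encodable.encode ds ∧ ApproximatesList x i ds τs

theorem Refines.abs_sub_lt {d : ℤ × ℕ} {m i : ℕ} {z : ℤ} {r : ℝ} (h : Refines d m z i)
    (hd : |dyadicVal d - r| < (2 : ℝ)⁻¹ ^ m) : |dyadicVal (z, i) - r| < (2 : ℝ)⁻¹ ^ i := by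
  rw [Refines, abs_sub_comm] at h
  have := abs_sub_le (dyadicVal (z, i)) (dyadicVal d) r
  linarith

/-- Initial segments of names can be prolonged to names, so a machine that computes `f` gives
correct answers when it runs with an initial segment of names. -/
theorem abs_sub_lt_of_runs {c : OracleCode} {l : ℕ} {f : (Fin l → ℝ) → ℝ} (hc : c.Computes f)
    {p : List ℕ} {y : Fin l → ℝ} {m : ℕ} {d : ℤ × ℕ}
    (hp : ∀ i (h : i < p.length), ∃ g : Fin l → ℤ × ℕ, p[i] = Encodable.encode (List.ofFn g) ∧
      ∀ j, |dyadicVal (g j) - y j| < (2 : ℝ)⁻¹ ^ i)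
    (hr : OracleCode.Runs c.toNat p m (Encodable.encode d)) :
    |dyadicVal d - f y| < (2 : ℝ)⁻¹ ^ m := by
  have : ∀ i, ∃ g : Fin l → ℤ × ℕ, (∀ j, |dyadicVal (g j) - y j| < (2 : ℝ)⁻¹ ^ i) ∧
      ∀ h : i < p.length, p[i] = Encodable.encode (List.ofFn g) := by
    intro i
    by_cases h : i < p.length
    · obtain ⟨g, hg, hg'⟩ := hp i h
      exact ⟨g, hg', fun _ => hg⟩
    · choose z hz using fun j => exists_dyadic_near (y j) i
      exact ⟨fun j => (z j, i), hz, fun h' => absurd h' h⟩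
  choose g hg hgp using this
  obtain ⟨d', hd', hlt⟩ := hc y (fun j i => g i j) (fun j i => hg i j) m
  have := hr.yields (O := nameOracle fun j i => g i j) hgp
  -- With the extended names as oracle the output is unique, so the output of the finite run is the
  -- one whose error is bounded.
  rwa [Encodable.encode_injective (Part.mem_unique this hd')]

/-- Induction on the derivation. At a function symbol the derived prefix is an initial segment of
names of the argument values at `x`, and `abs_sub_lt_of_runs` applies. Truth is required for every
term with the given number, so distinct symbols may share a program. -/
theorem TermJudgment.holds_of_derivable
    (hM : ∀ (k : ℕ) (f : L.Functions k),
      (M k f).Computes (fun x : Fin k → ℝ => FirstOrder.Language.Structure.funMap f x))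
    (x : Fin n → ℝ) {j : TermJudgment} (hj : Derivable termRules j) : j.Holds M x := by
  induction hj with
  | @intro j ps h _ ih =>
    rcases h with ((((⟨⟨⟨d, m, z, i⟩, l, l'⟩, ⟨hr, -⟩, h⟩ |
      ⟨⟨⟨⟨d, m, z, i⟩, c, p, m', y⟩, ts, b⟩, ⟨⟨⟨hr, hrun⟩, -⟩, hm, hy⟩, h⟩) | ⟨⟨b, i⟩, h⟩) |
      ⟨⟨t, ts, b, i, z, ys⟩, h⟩) | ⟨⟨ts, b⟩, h⟩) | ⟨⟨ts, b, p, y⟩, h⟩ <;>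
    (cases h; simp only [List.forall_mem_cons, List.not_mem_nil, false_imp_iff, implies_true,
      and_true] at ih)
    · intro hb τ hτ
      cases τ with
      | func f σ => simp [termCode, Nat.pair_eq_pair] at hτ
      | var k =>
        simp only [termCode, Nat.pair_eq_pair, true_and] at hτ
        have := (List.forall₂_iff_get.1 hb).2 l.length (by simp) (by simp [hτ])
        simp only [List.get_eq_getElem, List.getElem_append_right, le_refl, Nat.sub_self,
          List.getElem_cons_zero, List.getElem_ofFn, hτ] at this
        exact Refines.abs_sub_lt hr this
    · intro hb τ hτ
      cases τ with
      | var k => simp [termCode, Nat.pair_eq_pair] at hτ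
      | @func l f σ =>
        simp only [termCode, Nat.pair_eq_pair, true_and, encode_ofFn_termCode] at hτ
        obtain ⟨rfl, hts⟩ := hτ
        dsimp only at hm hy
        subst hm hy
        refine Refines.abs_sub_lt hr (abs_sub_lt_of_runs (hM l f) (fun i h => ?_) hrun)
        obtain ⟨ds, hds, happ⟩ := ih hb (List.ofFn σ) hts i h
        obtain ⟨g, rfl, hg⟩ := happ.exists_ofFn_left
        exact ⟨g, hds, hg⟩
    · intro hb τs hτ
      cases τs with
      | nil => exact ⟨[], by simp, .nil⟩
      | cons τ τs => simp [Encodable.encode_list_cons] at hτ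
    · intro hb τs hτ
      cases τs with
      | nil => simp at hτ
      | cons τ τs =>
        simp only [List.map_cons, Encodable.encode_list_cons, Nat.succ_eq_add_one,
          Nat.add_right_cancel_iff, Nat.pair_eq_pair, Encodable.encode_nat] at hτ
        obtain ⟨ds, rfl, hds⟩ := ih.2 hb τs hτ.2
        exact ⟨(z, i) :: ds, by simp [Encodable.encode_list_cons],
          .cons (ih.1 hb τ hτ.1) hds⟩
    · exact fun _ _ _ i h => absurd h (Nat.not_lt_zero i)
    · intro hb τs hτ i hi
      rcases lt_or_eq_of_le (Nat.lt_succ_iff.1 (by simpa using hi)) with h | h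
      · rw [List.getElem_append_left h]
        exact ih.1 hb τs hτ i h
      · subst h
        simpa using ih.2 hb τs hτ

theorem TermApprox.abs_sub_lt
    (hM : ∀ (k : ℕ) (f : L.Functions k),
      (M k f).Computes (fun x : Fin k → ℝ => FirstOrder.Language.Structure.funMap f x))
    {τ : L.Term (Fin n)} {b : Box} {i : ℕ} {z : ℤ} (h : TermApprox (termCode M τ) b i z)
    {x : Fin n → ℝ} (hb : b.Contains x) : |dyadicVal (z, i) - τ.realize x| < (2 : ℝ)⁻¹ ^ i :=
  TermJudgment.holds_of_derivable hM x h hb τ rfl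

end Soundness

/-! ### Completeness of the calculus for terms -/

section Completeness

open Filter

variable {L : FirstOrder.Language.{u, v}} [L.Structure ℝ] {M : ∀ k, L.Functions k → OracleCode}
  {n : ℕ}

/-- The hypothesis is strict, which leaves slack. For a variable the slack absorbs the size of the
box. For a function symbol, names of the argument values are fixed; the machine halts after using
finitely many of their entries, and by induction all of these are certified on every small enough
box. -/
theorem TermApprox.eventually
    (hM : ∀ (k : ℕ) (f : L.Functions k),
      (M k f).Computes (fun x : Fin k → ℝ => FirstOrder.Language.Structure.funMap f x))
    (x : Fin n → ℝ) (τ : L.Term (Fin n)) {i : ℕ} {z : ℤ}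
    (hz : |dyadicVal (z, i) - τ.realize x| < (2 : ℝ)⁻¹ ^ i) :
    ∀ᶠ N in atTop, ∀ b : Box, b.Near N x → TermApprox (termCode M τ) b i z := by
  induction τ generalizing i z with
  | var k =>
    filter_upwards [eventually_inv_two_pow_lt (sub_pos.2 hz)] with N hN b hb
    have hlen : b.length = n := by simpa using List.Forall₂.length_eq hb
    have hk : (k : ℕ) < b.length := hlen ▸ k.2
    have := (List.forall₂_iff_get.1 hb).2 k hk (by simp)
    simp only [List.get_eq_getElem, List.getElem_ofFn, Fin.eta] at this
    have key : Refines b[k].1 b[k].2 z i := by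
      have h2 := abs_sub_le (dyadicVal b[(k : ℕ)].1) (x k) (dyadicVal (z, i))
      rw [FirstOrder.Language.Term.realize_var, abs_sub_comm] at hN
      rw [Refines]
      simp only [Fin.getElem_fin]
      linarith
    have hb' : b.take k ++ b[(k : ℕ)] :: b.drop (k + 1) = b := by simp
    have := TermApprox.var (b := b.take k) (b' := b.drop (k + 1)) key
    simpa [hk.le, hb', termCode, Nat.min_eq_left hk.le] using this
  | @func l f σ ih =>
    choose ζ hζ using fun j m => exists_dyadic_near ((σ j).realize x) m
    have hname : ∀ j, IsName (fun m => (ζ j m, m)) ((σ j).realize x) := hζ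
    -- Half of the slack is spent on the error of the output `d`, the other half on the radius `2⁻ᵐ`
    -- in `Refines`.
    obtain ⟨m, hm⟩ := (eventually_inv_two_pow_lt (half_pos (sub_pos.2 hz))).exists
    obtain ⟨d, hd, hlt⟩ := hM l f (fun j => (σ j).realize x) _ hname m
    obtain ⟨k, hk⟩ := (OracleCode.Yields.eventually_runs hd).exists
    have href : Refines d m z i := by
      have h2 := abs_sub_le (dyadicVal d) ((FirstOrder.Language.Term.func f σ).realize x)
        (dyadicVal (z, i))
      rw [abs_sub_comm ((FirstOrder.Language.Term.func f σ).realize x)] at h2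
      rw [Refines]
      change |dyadicVal d - (FirstOrder.Language.Term.func f σ).realize x| < _ at hlt
      linarith
    have hev : ∀ᶠ N in atTop, ∀ m ∈ Finset.range k, ∀ j, ∀ b : Box, b.Near N x →
        TermApprox (termCode M (σ j)) b m (ζ j m) := by
      rw [Filter.eventually_all_finset]
      exact fun m _ => eventually_all.2 fun j => ih j (hζ j m)
    filter_upwards [hev] with N hN b hb
    rw [termCode, encode_ofFn_termCode]
    refine TermApprox.func href hk ?_
    have : ∀ k' ≤ k, PrefixApprox (Encodable.encode ((List.ofFn σ).map (termCode M))) b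
        ((List.range k').map (nameOracle fun j m => (ζ j m, m))) := by
      intro k'
      induction k' with
      | zero => exact fun _ => PrefixApprox.nil
      | succ k' ih' =>
        intro hk'
        rw [List.range_succ, List.map_append]
        refine (ih' (Nat.le_of_succ_le hk')).snoc ?_
        have := ListApprox.of_forall₂ (M := M) (b := b) (i := k')
          (zs := List.ofFn fun j => ζ j k') (τs := List.ofFn σ)
          (List.forall₂_ofFn_iff.2 fun j => hN k' (Finset.mem_range.2 hk') j b hb)
        simpa [nameOracle, Function.comp_def, List.map_ofFn] using this
    exact this k le_rfl

end Completeness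

end RealLogic

/-! ### Preimages and intersections of enumerable sets -/

namespace EffectivelyEnumerable

variable {α β : Type*} [Primcodable α] [Primcodable β]

/-- All pairs `(b, a)` with `b ∈ s` are enumerated, and those with `b = f a` are kept. -/
theorem preimage {s : Set β} (hs : EffectivelyEnumerable s) {f : α → β} (hf : Primrec f) :
    EffectivelyEnumerable (f ⁻¹' s) := by
  classical
  convert ((hs.prod (univ : EffectivelyEnumerable (Set.univ : Set α))).sep
    (Primrec.eq.comp Primrec.fst (hf.comp Primrec.snd) :
      PrimrecPred fun x : β × α => x.1 = f x.2)).image Primrec.snd using 1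
  ext a
  constructor
  · exact fun h => ⟨(f a, a), ⟨⟨h, trivial⟩, rfl⟩, rfl⟩
  · rintro ⟨⟨b, a'⟩, ⟨⟨h, -⟩, e⟩, rfl⟩
    dsimp only at e
    subst e
    exact h

theorem inter {s t : Set α} (hs : EffectivelyEnumerable s) (ht : EffectivelyEnumerable t) :
    EffectivelyEnumerable (s ∩ t) := by
  convert (hs.prod ht).preimage (f := fun a => (a, a)) (by fun_prop) using 1
  rfl

end EffectivelyEnumerable

theorem Primrec.cond_comp {α β : Type*} [Primcodable α] [Primcodable β] {c : α → Bool}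
    {f g : α → β} (hc : Primrec c) (hf : Primrec f) (hg : Primrec g) :
    Primrec fun a => bif c a then f a else g a :=
  Primrec.cond hc hf hg

attribute [fun_prop] Primrec.cond_comp

/-! ### Derivation calculus for bounded formulas -/

namespace RealLogic

/-- The dyadic rational `(p - q) / 2 ^ m`. -/
def gridPoint (p q m : ℕ) : ℤ × ℕ := (Int.subNatNat p q, m)

theorem primrec_gridPoint {α : Type*} [Primcodable α] {f g h : α → ℕ} (hf : Primrec f)
    (hg : Primrec g) (hh : Primrec h) : Primrec fun a => gridPoint (f a) (g a) (h a) := by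
  unfold gridPoint
  fun_prop

attribute [fun_prop] primrec_gridPoint

theorem dyadicVal_gridPoint (p q m : ℕ) :
    dyadicVal (gridPoint p q m) = ((p : ℝ) - q) * (2 : ℝ)⁻¹ ^ m := by
  rw [gridPoint, dyadicVal, Int.subNatNat_eq_coe, inv_pow, div_eq_mul_inv]
  push_cast
  rfl

theorem dyadicVal_gridPoint_add (p q k m : ℕ) :
    dyadicVal (gridPoint (p + k) q m) = dyadicVal (gridPoint p q m) + k * (2 : ℝ)⁻¹ ^ m := by
  simp only [dyadicVal_gridPoint]
  push_cast
  ring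

/-- The values of the terms `u` and `v` are derivably within `2⁻ᵐ` of the two ends of the grid
interval from `(p - q) / 2 ^ m` to `(p + c - q) / 2 ^ m`. -/
def BoundsApprox (u v : ℕ) (b : Box) (m p q c : ℕ) : Prop :=
  TermApprox u b m (Int.subNatNat p q) ∧ TermApprox v b m (Int.subNatNat (p + c) q) ∨
    TermApprox u b m (Int.subNatNat (p + c) q) ∧ TermApprox v b m (Int.subNatNat p q)

theorem effectivelyEnumerable_boundsApprox :
    EffectivelyEnumerable {x : ℕ × ℕ × Box × ℕ × ℕ × ℕ × ℕ |
      BoundsApprox x.1 x.2.1 x.2.2.1 x.2.2.2.1 x.2.2.2.2.1 x.2.2.2.2.2.1 x.2.2.2.2.2.2} := by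
  have h {f : ℕ × ℕ × Box × ℕ × ℕ × ℕ × ℕ → ℕ × Box × ℕ × ℤ} (hf : Primrec f) :
      EffectivelyEnumerable {x | TermApprox (f x).1 (f x).2.1 (f x).2.2.1 (f x).2.2.2} :=
    effectivelyEnumerable_derivable_termRules.preimage (f := fun x => .inl (f x)) (by fun_prop)
  exact ((h (f := fun x => (x.1, x.2.2.1, x.2.2.2.1,
        Int.subNatNat x.2.2.2.2.1 x.2.2.2.2.2.1)) (by fun_prop)).inter
      (h (f := fun x => (x.2.1, x.2.2.1, x.2.2.2.1,
        Int.subNatNat (x.2.2.2.2.1 + x.2.2.2.2.2.2) x.2.2.2.2.2.1)) (by fun_prop))).union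
    ((h (f := fun x => (x.1, x.2.2.1, x.2.2.2.1,
        Int.subNatNat (x.2.2.2.2.1 + x.2.2.2.2.2.2) x.2.2.2.2.2.1)) (by fun_prop)).inter
      (h (f := fun x => (x.2.1, x.2.2.1, x.2.2.2.1,
        Int.subNatNat x.2.2.2.2.1 x.2.2.2.2.2.1)) (by fun_prop)))

/-- The numerator of the approximation at level `e` that settles an atomic formula: at least `0`
to assert it up to `2⁻ᵉ`, and at most `-1` to refute it. -/
def atomNumerator (s : Bool) (n : ℕ) : ℤ :=
  Int.subNatNat (bif s then n else 0) (bif s then 0 else n + 1)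

/-- Judgments about formulas. The judgment `(s, e, φ, b)` about a quantifier-free or a bounded
formula says that `φ` with all atoms `t > 0` and `t ≥ 0` replaced by `t > -2⁻ᵉ` holds everywhere
on the box `b` if `s = true`, and that `φ` fails everywhere on `b` if `s = false`. A judgment of
the third kind says this on the product of `b` with each of `c` consecutive grid intervals. -/
abbrev FormulaJudgment : Type :=
  (Bool × ℕ × ℕ × Box) ⊕ (Bool × ℕ × ℕ × Box) ⊕ (Bool × ℕ × ℕ × Box × ℕ × ℕ × ℕ × ℕ)

instance : Primcodable (Bool × ℕ × ℕ × Box × ℕ × ℕ × ℕ × ℕ) := inferInstance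

instance : Primcodable FormulaJudgment := inferInstance

/-- The derivation rules for formulas. -/
def formulaRules : Set (FormulaJudgment × List FormulaJudgment) :=
  (fun (s, e, g, t, b, _) => (.inl (s, e, Nat.pair (bif g then 0 else 1) t, b), []) :
      Bool × ℕ × Bool × ℕ × Box × ℕ → _) ''
    {x | TermApprox x.2.2.2.1 x.2.2.2.2.1 x.2.1 (atomNumerator x.1 x.2.2.2.2.2)} ∪
  Set.range (fun (s, e, k, l, b) =>
    (.inl (s, e, Nat.pair (bif s then 2 else 3) (Nat.pair k l), b),
      [.inl (s, e, k, b), .inl (s, e, l, b)]) : Bool × ℕ × ℕ × ℕ × Box → _) ∪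
  Set.range (fun (s, e, g, k, l, b) =>
    (.inl (s, e, Nat.pair (bif s then 3 else 2) (Nat.pair k l), b),
      [.inl (s, e, bif g then k else l, b)]) : Bool × ℕ × Bool × ℕ × ℕ × Box → _) ∪
  Set.range (fun (s, e, k, b) =>
    (.inr (.inl (s, e, Nat.pair 0 k, b)), [.inl (s, e, k, b)]) : Bool × ℕ × ℕ × Box → _) ∪
  (fun ((u, v, b, m, p, q, _), s, e, k, i) =>
    (.inr (.inl (s, e, Nat.pair (bif s then 1 else 2) (Nat.pair u (Nat.pair v k)), b)),
      [.inr (.inl (s, e, k, b ++ [(gridPoint (p + i) q m, m)]))]) :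
      (ℕ × ℕ × Box × ℕ × ℕ × ℕ × ℕ) × Bool × ℕ × ℕ × ℕ → _) ''
    {x ∈ {x | BoundsApprox x.1 x.2.1 x.2.2.1 x.2.2.2.1 x.2.2.2.2.1 x.2.2.2.2.2.1 x.2.2.2.2.2.2} ×ˢ
      Set.univ | x.2.2.2.2 ≤ x.1.2.2.2.2.2.2} ∪
  (fun ((u, v, b, m, p, q, c), s, e, k) =>
    (.inr (.inl (s, e, Nat.pair (bif s then 2 else 1) (Nat.pair u (Nat.pair v k)), b)),
      [.inr (.inr (s, e, k, b, m, p, q, c + 1))]) :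
      (ℕ × ℕ × Box × ℕ × ℕ × ℕ × ℕ) × Bool × ℕ × ℕ → _) ''
    ({x | BoundsApprox x.1 x.2.1 x.2.2.1 x.2.2.2.1 x.2.2.2.2.1 x.2.2.2.2.2.1 x.2.2.2.2.2.2} ×ˢ
      Set.univ) ∪
  Set.range (fun (s, e, k, b, m, p, q) => (.inr (.inr (s, e, k, b, m, p, q, 0)), []) :
    Bool × ℕ × ℕ × Box × ℕ × ℕ × ℕ → _) ∪
  Set.range (fun (s, e, k, b, m, p, q, c) => (.inr (.inr (s, e, k, b, m, p, q, c + 1)),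
    [.inr (.inl (s, e, k, b ++ [(gridPoint p q m, m)])),
      .inr (.inr (s, e, k, b, m, p + 1, q, c))]) : Bool × ℕ × ℕ × Box × ℕ × ℕ × ℕ × ℕ → _)

theorem effectivelyEnumerable_formulaRules : EffectivelyEnumerable formulaRules := by
  unfold formulaRules
  repeat' apply EffectivelyEnumerable.union
  · refine EffectivelyEnumerable.image ?_ (by fun_prop)
    refine effectivelyEnumerable_derivable_termRules.preimage
      (f := fun x : Bool × ℕ × Bool × ℕ × Box × ℕ =>
        .inl (x.2.2.2.1, x.2.2.2.2.1, x.2.1, atomNumerator x.1 x.2.2.2.2.2)) ?_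
    unfold atomNumerator
    fun_prop
  rotate_left 3
  · exact ((effectivelyEnumerable_boundsApprox.prod .univ).sep
      (Primrec.nat_le.comp (by fun_prop) (by fun_prop))).image (by fun_prop)
  · exact (effectivelyEnumerable_boundsApprox.prod .univ).image (by fun_prop)
  all_goals exact EffectivelyEnumerable.range (by fun_prop)

/-- The judgment about a quantifier-free formula is derivable. -/
def QFDerivable (s : Bool) (e k : ℕ) (b : Box) : Prop :=
  Derivable formulaRules (.inl (s, e, k, b))

/-- The judgment about a bounded formula is derivable. -/
def BddDerivable (s : Bool) (e k : ℕ) (b : Box) : Prop :=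
  Derivable formulaRules (.inr (.inl (s, e, k, b)))

/-- The judgment about a bounded formula and consecutive grid intervals is derivable. -/
def GridDerivable (s : Bool) (e k : ℕ) (b : Box) (m p q c : ℕ) : Prop :=
  Derivable formulaRules (.inr (.inr (s, e, k, b, m, p, q, c)))

theorem effectivelyEnumerable_derivable_formulaRules :
    EffectivelyEnumerable {j : FormulaJudgment | Derivable formulaRules j} :=
  effectivelyEnumerable_formulaRules.derivable

section Rules

variable {s : Bool} {e t k l u v m p q c i n : ℕ} {b : Box}

/-- Strict and non-strict atoms share this rule: values above `-2⁻ᵉ` are accepted and only negative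
values are refuted, so the case of equality plays no role. -/
theorem QFDerivable.atom (g : Bool) (h : TermApprox t b e (atomNumerator s n)) :
    QFDerivable s e (Nat.pair (bif g then 0 else 1) t) b :=
  .intro (ps := []) (by iterate 7 left
                        exact ⟨(s, e, g, t, b, n), h, rfl⟩) (by simp)

/-- Asserting a conjunction and refuting a disjunction both take two premises, so `s` selects the
connective. The same duality merges the remaining rules in pairs. -/
theorem QFDerivable.conj (h₁ : QFDerivable s e k b) (h₂ : QFDerivable s e l b) :
    QFDerivable s e (Nat.pair (bif s then 2 else 3) (Nat.pair k l)) b :=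
  .intro (by iterate 6 left
             exact .inr ⟨(s, e, k, l, b), rfl⟩)
    (by simpa only [List.forall_mem_cons] using ⟨h₁, h₂, by simp⟩)

theorem QFDerivable.disj (g : Bool) (h : QFDerivable s e (bif g then k else l) b) :
    QFDerivable s e (Nat.pair (bif s then 3 else 2) (Nat.pair k l)) b :=
  .intro (by iterate 5 left
             exact .inr ⟨(s, e, g, k, l, b), rfl⟩)
    (by simpa only [List.forall_mem_cons] using ⟨h, by simp⟩)

theorem BddDerivable.matrix (h : QFDerivable s e k b) : BddDerivable s e (Nat.pair 0 k) b :=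
  .intro (by iterate 4 left
             exact .inr ⟨(s, e, k, b), rfl⟩)
    (by simpa only [List.forall_mem_cons] using ⟨h, by simp⟩)

/-- Sound because every grid ball meets the quantifier's interval (`GridNear.exists_mem_uIcc`),
although its centre may lie outside. -/
theorem BddDerivable.ex (hb : BoundsApprox u v b m p q c) (hi : i ≤ c)
    (h : BddDerivable s e k (b ++ [(gridPoint (p + i) q m, m)])) :
    BddDerivable s e (Nat.pair (bif s then 1 else 2) (Nat.pair u (Nat.pair v k))) b :=
  .intro (by iterate 3 left
             exact .inr ⟨((u, v, b, m, p, q, c), s, e, k, i), ⟨⟨hb, trivial⟩, hi⟩, rfl⟩)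
    (by simpa only [List.forall_mem_cons] using ⟨h, by simp⟩)

/-- Sound because the balls around the grid points cover the interval (`GridNear.exists_gridPoint`).
A grid of `c` steps has `c + 1` points. -/
theorem BddDerivable.all (hb : BoundsApprox u v b m p q c)
    (h : GridDerivable s e k b m p q (c + 1)) :
    BddDerivable s e (Nat.pair (bif s then 2 else 1) (Nat.pair u (Nat.pair v k))) b :=
  .intro (by iterate 2 left
             exact .inr ⟨((u, v, b, m, p, q, c), s, e, k), ⟨hb, trivial⟩, rfl⟩)
    (by simpa only [List.forall_mem_cons] using ⟨h, by simp⟩)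

theorem GridDerivable.zero : GridDerivable s e k b m p q 0 :=
  .intro (ps := []) (.inl (.inr ⟨(s, e, k, b, m, p, q), rfl⟩)) (by simp)

theorem GridDerivable.succ (h₁ : BddDerivable s e k (b ++ [(gridPoint p q m, m)]))
    (h₂ : GridDerivable s e k b m (p + 1) q c) : GridDerivable s e k b m p q (c + 1) :=
  .intro (.inr ⟨(s, e, k, b, m, p, q, c), rfl⟩)
    (by simpa only [List.forall_mem_cons] using ⟨h₁, h₂, by simp⟩)

theorem GridDerivable.of_forall
    (h : ∀ i < c, BddDerivable s e k (b ++ [(gridPoint (p + i) q m, m)])) :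
    GridDerivable s e k b m p q c := by
  induction c generalizing p with
  | zero => exact .zero
  | succ c ih =>
    refine .succ (h 0 (Nat.succ_pos c)) (ih fun i hi => ?_)
    rw [add_assoc, add_comm 1 i]
    exact h (i + 1) (Nat.succ_lt_succ hi)

end Rules

/-! ### Grid intervals -/

section Grid

/-- The numbers `u` and `v` are within `2⁻ᵐ` of the two ends of the grid interval from
`(p - q) / 2 ^ m` to `(p + c - q) / 2 ^ m`. -/
def GridNear (u v : ℝ) (m p q c : ℕ) : Prop :=
  |dyadicVal (gridPoint p q m) - u| < (2 : ℝ)⁻¹ ^ m ∧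
      |dyadicVal (gridPoint (p + c) q m) - v| < (2 : ℝ)⁻¹ ^ m ∨
    |dyadicVal (gridPoint (p + c) q m) - u| < (2 : ℝ)⁻¹ ^ m ∧
      |dyadicVal (gridPoint p q m) - v| < (2 : ℝ)⁻¹ ^ m

variable {u v : ℝ} {m p q c : ℕ}

theorem GridNear.symm (h : GridNear u v m p q c) : GridNear v u m p q c :=
  Or.elim h (fun h => .inr ⟨h.2, h.1⟩) fun h => .inl ⟨h.2, h.1⟩

/-- A grid point that is not within `2⁻ᵐ` of `u` or of `v` lies between them, and can be taken as
`y` itself. -/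
theorem GridNear.exists_mem_uIcc (h : GridNear u v m p q c) {i : ℕ} (hi : i ≤ c) :
    ∃ y ∈ Set.uIcc u v, |dyadicVal (gridPoint (p + i) q m) - y| < (2 : ℝ)⁻¹ ^ m := by
  wlog h' : |dyadicVal (gridPoint p q m) - u| < (2 : ℝ)⁻¹ ^ m ∧
      |dyadicVal (gridPoint (p + c) q m) - v| < (2 : ℝ)⁻¹ ^ m generalizing u v
  · rw [Set.uIcc_comm]
    exact this h.symm (h.elim (fun h => absurd h h') fun h => ⟨h.2, h.1⟩)
  obtain ⟨h1, h2⟩ := h'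
  rw [dyadicVal_gridPoint_add, abs_lt] at h2
  rw [abs_lt] at h1
  rw [dyadicVal_gridPoint_add]
  have hε := inv_two_pow_pos m
  have hic : (i : ℝ) * (2 : ℝ)⁻¹ ^ m ≤ c * (2 : ℝ)⁻¹ ^ m := by gcongr
  have hi0 : 0 ≤ (i : ℝ) * (2 : ℝ)⁻¹ ^ m := by positivity
  generalize dyadicVal (gridPoint p q m) = r at *
  generalize (i : ℝ) * (2 : ℝ)⁻¹ ^ m = a at *
  generalize (c : ℝ) * (2 : ℝ)⁻¹ ^ m = a' at *
  generalize (2 : ℝ)⁻¹ ^ m = ε at *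
  by_cases hu : |r + a - u| < ε
  · exact ⟨u, Set.left_mem_uIcc, hu⟩
  by_cases hv : |r + a - v| < ε
  · exact ⟨v, Set.right_mem_uIcc, hv⟩
  refine ⟨r + a, Set.mem_uIcc_of_le ?_ ?_, by simpa using hε⟩
  · by_contra hlt
    exact hu (abs_lt.2 ⟨by linarith, by linarith⟩)
  · by_contra hlt
    exact hv (abs_lt.2 ⟨by linarith, by linarith⟩)

/-- Rounding `y` down to the grid works between the first and the last grid point. Beyond them `y`
is less than one mesh away from the nearer of the two. -/
theorem GridNear.exists_gridPoint (h : GridNear u v m p q c) {y : ℝ} (hy : y ∈ Set.uIcc u v) :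
    ∃ i ≤ c, |dyadicVal (gridPoint (p + i) q m) - y| < (2 : ℝ)⁻¹ ^ m := by
  wlog h' : |dyadicVal (gridPoint p q m) - u| < (2 : ℝ)⁻¹ ^ m ∧
      |dyadicVal (gridPoint (p + c) q m) - v| < (2 : ℝ)⁻¹ ^ m generalizing u v
  · rw [Set.uIcc_comm] at hy
    exact this h.symm hy (h.elim (fun h => absurd h h') fun h => ⟨h.2, h.1⟩)
  obtain ⟨h1, h2⟩ := h'
  rw [dyadicVal_gridPoint_add, abs_lt] at h2
  rw [abs_lt] at h1
  simp only [dyadicVal_gridPoint_add]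
  have hε := inv_two_pow_pos m
  have hc0 : 0 ≤ (c : ℝ) * (2 : ℝ)⁻¹ ^ m := by positivity
  generalize dyadicVal (gridPoint p q m) = r at *
  generalize (2 : ℝ)⁻¹ ^ m = ε at *
  have hlo : r - ε < y := by
    rcases Set.mem_uIcc.1 hy with hy | hy <;> linarith
  have hhi : y < r + c * ε + ε := by
    rcases Set.mem_uIcc.1 hy with hy | hy <;> linarith
  rcases lt_or_ge y r with hyr | hyr
  · exact ⟨0, Nat.zero_le c, abs_lt.2 (by push_cast; constructor <;> linarith)⟩
  rcases le_total (r + c * ε) y with hyc | hyc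
  · exact ⟨c, le_rfl, abs_lt.2 (by constructor <;> linarith)⟩
  have hnn : 0 ≤ (y - r) / ε := div_nonneg (by linarith) hε.le
  have f1 := Nat.floor_le hnn
  have f2 := Nat.lt_floor_add_one ((y - r) / ε)
  rw [le_div_iff₀ hε] at f1
  rw [div_lt_iff₀ hε] at f2
  refine ⟨⌊(y - r) / ε⌋₊, ?_, abs_lt.2 ⟨by linarith, by linarith⟩⟩
  refine Nat.floor_le_of_le ?_
  rw [div_le_iff₀ hε]
  linarith

theorem exists_gridNear (u v : ℝ) (m : ℕ) : ∃ p q c, GridNear u v m p q c := by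
  wlog h : ∃ z z' : ℤ, z ≤ z' ∧ |dyadicVal (z, m) - u| < (2 : ℝ)⁻¹ ^ m ∧
      |dyadicVal (z', m) - v| < (2 : ℝ)⁻¹ ^ m generalizing u v
  · obtain ⟨z, hz⟩ := exists_dyadic_near u m
    obtain ⟨z', hz'⟩ := exists_dyadic_near v m
    rcases le_total z z' with hle | hle
    · exact absurd ⟨z, z', hle, hz, hz'⟩ h
    · obtain ⟨p, q, c, h⟩ := this v u ⟨z', z, hle, hz', hz⟩
      exact ⟨p, q, c, h.symm⟩
  obtain ⟨z, z', hle, hz, hz'⟩ := h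
  -- An integer is the difference of its positive and negative parts.
  refine ⟨z.toNat, (-z).toNat, (z' - z).toNat, .inl ⟨?_, ?_⟩⟩
  · rwa [gridPoint, Int.subNatNat_eq_coe, show (z.toNat : ℤ) - (-z).toNat = z by omega]
  · rwa [gridPoint, Int.subNatNat_eq_coe,
      show ((z.toNat + (z' - z).toNat : ℕ) : ℤ) - (-z).toNat = z' by omega]

end Grid

end RealLogic

namespace RealLogic

/-! ### Sign-based satisfaction, truth and weakening -/

section Semantics

variable {L : FirstOrder.Language.{u, v}} [L.Structure ℝ]

/-- Truth of a quantifier-free formula when the atoms `t > 0` and `t ≥ 0` are both read as `P t`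
and, if `s = false`, conjunction and disjunction are interchanged. -/
def QFFormula.Sat (P : ℝ → Prop) (s : Bool) {n : ℕ} (x : Fin n → ℝ) : QFFormula L n → Prop
  | pos t => P (t.realize x)
  | nonneg t => P (t.realize x)
  | and φ ψ => bif s then φ.Sat P s x ∧ ψ.Sat P s x else φ.Sat P s x ∨ ψ.Sat P s x
  | or φ ψ => bif s then φ.Sat P s x ∨ ψ.Sat P s x else φ.Sat P s x ∧ ψ.Sat P s x

/-- Truth of a bounded formula when the atoms `t > 0` and `t ≥ 0` are both read as `P t` and, if
`s = false`, all connectives and quantifiers are replaced by their duals. -/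
def BddFormula.Sat (P : ℝ → Prop) (s : Bool) : {n : ℕ} → BddFormula L n → (Fin n → ℝ) → Prop
  | _, matrix ψ, x => ψ.Sat P s x
  | _, ex a b φ, x =>
      bif s then ∃ y ∈ Set.uIcc (a.realize x) (b.realize x), φ.Sat P s (Fin.snoc x y)
      else ∀ y ∈ Set.uIcc (a.realize x) (b.realize x), φ.Sat P s (Fin.snoc x y)
  | _, all a b φ, x =>
      bif s then ∀ y ∈ Set.uIcc (a.realize x) (b.realize x), φ.Sat P s (Fin.snoc x y)
      else ∃ y ∈ Set.uIcc (a.realize x) (b.realize x), φ.Sat P s (Fin.snoc x y)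

theorem QFFormula.sat_false_of_not_sat_true {P : ℝ → Prop} {n : ℕ} {x : Fin n → ℝ}
    {ψ : QFFormula L n} (h : ¬ψ.Sat P true x) : ψ.Sat (fun r => ¬P r) false x := by
  induction ψ with
  | pos t => exact h
  | nonneg t => exact h
  | and φ ψ ih₁ ih₂ =>
    simp only [Sat, cond_true, cond_false, not_and_or] at h ⊢
    exact h.imp ih₁ ih₂
  | or φ ψ ih₁ ih₂ =>
    simp only [Sat, cond_true, cond_false, not_or] at h ⊢
    exact h.imp ih₁ ih₂

theorem BddFormula.sat_false_of_not_sat_true {P : ℝ → Prop} {n : ℕ} {x : Fin n → ℝ}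
    {φ : BddFormula L n} (h : ¬φ.Sat P true x) : φ.Sat (fun r => ¬P r) false x := by
  induction φ with
  | matrix ψ => exact QFFormula.sat_false_of_not_sat_true h
  | ex a b φ ih =>
    simp only [Sat, cond_true, cond_false, not_exists, not_and] at h ⊢
    exact fun y hy => ih (h y hy)
  | all a b φ ih =>
    simp only [Sat, cond_true, cond_false, not_forall] at h ⊢
    obtain ⟨y, hy, h⟩ := h
    exact ⟨y, hy, ih h⟩

/-- A negative value refutes `t > 0` and `t ≥ 0` alike. -/
theorem QFFormula.not_realize_of_sat_false {P : ℝ → Prop} (hP : ∀ r, P r → r < 0) {n : ℕ}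
    {x : Fin n → ℝ} {ψ : QFFormula L n} (h : ψ.Sat P false x) : ¬ψ.Realize x := by
  induction ψ with
  | pos t => exact (hP _ h).not_gt
  | nonneg t => exact (hP _ h).not_ge
  | and φ ψ ih₁ ih₂ =>
    simp only [Sat, Realize, cond_false, not_and_or] at h ⊢
    exact h.imp ih₁ ih₂
  | or φ ψ ih₁ ih₂ =>
    simp only [Sat, Realize, cond_false, not_or] at h ⊢
    exact h.imp ih₁ ih₂

theorem BddFormula.not_realize_of_sat_false {P : ℝ → Prop} (hP : ∀ r, P r → r < 0) {n : ℕ}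
    {x : Fin n → ℝ} {φ : BddFormula L n} (h : φ.Sat P false x) : ¬φ.Realize x := by
  induction φ with
  | matrix ψ => exact QFFormula.not_realize_of_sat_false hP h
  | ex a b φ ih =>
    simp only [Sat, Realize, cond_false, not_exists, not_and] at h ⊢
    exact fun y hy => ih (h y hy)
  | all a b φ ih =>
    simp only [Sat, Realize, cond_false, not_forall] at h ⊢
    obtain ⟨y, hy, h⟩ := h
    exact ⟨y, hy, ih h⟩

theorem BasicSymbols.realize_sub_constTerm (B : BasicSymbols L) {n : ℕ} (x : Fin n → ℝ)
    (t : L.Term (Fin n)) (q : ℚ) :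
    (B.sub t (B.constTerm q)).realize x = t.realize x - q := by
  simp [BasicSymbols.sub, BasicSymbols.constTerm, B.add_eval, B.neg_eval, B.const_eval, sub_eq_add_neg]

theorem QFFormula.realize_weaken_of_sat_true (B : BasicSymbols L) {δ : ℚ} {P : ℝ → Prop}
    (hP : ∀ r, P r → -(δ : ℝ) < r) {n : ℕ} {x : Fin n → ℝ} {ψ : QFFormula L n}
    (h : ψ.Sat P true x) : (ψ.weaken B δ).Realize x := by
  induction ψ with
  | pos t =>
    have := hP _ h
    simp only [weaken, Realize, B.realize_sub_constTerm]
    push_cast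
    linarith
  | nonneg t =>
    have := hP _ h
    simp only [weaken, Realize, B.realize_sub_constTerm]
    push_cast
    linarith
  | and φ ψ ih₁ ih₂ => exact And.imp ih₁ ih₂ h
  | or φ ψ ih₁ ih₂ => exact Or.imp ih₁ ih₂ h

theorem BddFormula.realize_weaken_of_sat_true (B : BasicSymbols L) {δ : ℚ} {P : ℝ → Prop}
    (hP : ∀ r, P r → -(δ : ℝ) < r) {n : ℕ} {x : Fin n → ℝ} {φ : BddFormula L n}
    (h : φ.Sat P true x) : (φ.weaken B δ).Realize x := by
  induction φ with
  | matrix ψ => exact QFFormula.realize_weaken_of_sat_true B hP h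
  | ex a b φ ih => exact Exists.imp (fun y => And.imp_right ih) h
  | all a b φ ih => exact fun y hy => ih (h y hy)

end Semantics

/-- The property of the value of an atomic term that is shown by a derivation. -/
def DerivedSign (s : Bool) (e : ℕ) (r : ℝ) : Prop :=
  if s then -(2 : ℝ)⁻¹ ^ e < r else r < 0

/-- A property of the value of an atomic term that guarantees a derivation. -/
def DerivableSign (s : Bool) (e : ℕ) (r : ℝ) : Prop :=
  if s then -(2 : ℝ)⁻¹ ^ e < r else r ≤ -(2 : ℝ)⁻¹ ^ e

/-- A numerator at least `0` with error below one unit `2⁻ᵉ` forces `r > -2⁻ᵉ`; a numerator at most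
`-1` forces `r < 0`. -/
theorem derivedSign_of_abs_sub_lt {s : Bool} {e n : ℕ} {r : ℝ}
    (h : |dyadicVal (atomNumerator s n, e) - r| < (2 : ℝ)⁻¹ ^ e) : DerivedSign s e r := by
  change |dyadicVal (gridPoint _ _ e) - r| < _ at h
  rw [dyadicVal_gridPoint, abs_lt] at h
  have hε := inv_two_pow_pos e
  have hn : 0 ≤ (n : ℝ) * (2 : ℝ)⁻¹ ^ e := by positivity
  cases s <;> simp only [DerivedSign, cond_true, cond_false, if_true, Bool.false_eq_true,
    if_false, Nat.cast_zero, Nat.cast_add, Nat.cast_one] at h ⊢ <;> nlinarith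

theorem exists_atomNumerator {s : Bool} {e : ℕ} {r : ℝ} (h : DerivableSign s e r) :
    ∃ n, |dyadicVal (atomNumerator s n, e) - r| < (2 : ℝ)⁻¹ ^ e := by
  have hε := inv_two_pow_pos e
  have key : ∀ r : ℝ, -(2 : ℝ)⁻¹ ^ e < r → ∃ n : ℕ, |n * (2 : ℝ)⁻¹ ^ e - r| < (2 : ℝ)⁻¹ ^ e := by
    intro r hr
    rcases lt_or_ge r 0 with h0 | h0
    · exact ⟨0, abs_lt.2 (by push_cast; constructor <;> linarith)⟩
    · have f1 := Nat.floor_le (div_nonneg h0 hε.le)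
      have f2 := Nat.lt_floor_add_one (r / (2 : ℝ)⁻¹ ^ e)
      rw [le_div_iff₀ hε] at f1
      rw [div_lt_iff₀ hε] at f2
      exact ⟨⌊r / (2 : ℝ)⁻¹ ^ e⌋₊, abs_lt.2 ⟨by linarith, by linarith⟩⟩
  change ∃ n, |dyadicVal (gridPoint _ _ e) - r| < _
  simp only [dyadicVal_gridPoint]
  cases s <;> simp only [DerivableSign, if_true, Bool.false_eq_true, if_false] at h
  -- In the refuting case the numerator is `-(n + 1)`; a change of sign and a shift by one unit
  -- reduce it to `key`.
  · obtain ⟨n, hn⟩ := key (-r - (2 : ℝ)⁻¹ ^ e) (by linarith)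
    refine ⟨n, ?_⟩
    rw [← abs_neg]
    convert hn using 2
    simp only [cond_false]
    push_cast
    ring
  · obtain ⟨n, hn⟩ := key r h
    exact ⟨n, by simpa using hn⟩

/-! ### Soundness of the calculus for formulas -/

section Soundness

variable {L : FirstOrder.Language.{u, v}} [L.Structure ℝ] {M : ∀ k, L.Functions k → OracleCode}

theorem BoundsApprox.gridNear
    (hM : ∀ (k : ℕ) (f : L.Functions k),
      (M k f).Computes (fun x : Fin k → ℝ => FirstOrder.Language.Structure.funMap f x))
    {n : ℕ} {a a' : L.Term (Fin n)} {b : Box} {m p q c : ℕ}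
    (h : BoundsApprox (termCode M a) (termCode M a') b m p q c) {x : Fin n → ℝ}
    (hb : b.Contains x) : GridNear (a.realize x) (a'.realize x) m p q c :=
  h.imp (And.imp (·.abs_sub_lt hM hb) (·.abs_sub_lt hM hb))
    (And.imp (·.abs_sub_lt hM hb) (·.abs_sub_lt hM hb))

/-- Truth of a judgment about formulas. -/
def FormulaJudgment.Holds (M : ∀ k, L.Functions k → OracleCode) : FormulaJudgment → Prop
  | .inl (s, e, k, b) => ∀ (n : ℕ) (x : Fin n → ℝ) (ψ : QFFormula L n), k = ψ.code M →
      b.Contains x → ψ.Sat (DerivedSign s e) s x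
  | .inr (.inl (s, e, k, b)) => ∀ (n : ℕ) (x : Fin n → ℝ) (φ : BddFormula L n), k = φ.code M →
      b.Contains x → φ.Sat (DerivedSign s e) s x
  | .inr (.inr (s, e, k, b, m, p, q, c)) => ∀ (n : ℕ) (x : Fin n → ℝ) (φ : BddFormula L (n + 1)),
      k = φ.code M → b.Contains x → ∀ i < c, ∀ y : ℝ,
        |dyadicVal (gridPoint (p + i) q m) - y| < (2 : ℝ)⁻¹ ^ m →
          φ.Sat (DerivedSign s e) s (Fin.snoc x y)

/-- A judgment speaks of all points of its box. Hence a grid ball that meets the interval yields a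
witness, and grid balls that cover it yield all instances. The number of variables is quantified
inside `Holds` because it grows at each quantifier. -/
theorem FormulaJudgment.holds_of_derivable
    (hM : ∀ (k : ℕ) (f : L.Functions k),
      (M k f).Computes (fun x : Fin k → ℝ => FirstOrder.Language.Structure.funMap f x))
    {j : FormulaJudgment} (hj : Derivable formulaRules j) : j.Holds M := by
  induction hj with
  | @intro j ps h _ ih =>
    rcases h with ((((((⟨⟨s, e, g, t, b, n⟩, ht, h⟩ | ⟨⟨s, e, k, l, b⟩, h⟩) |
      ⟨⟨s, e, g, k, l, b⟩, h⟩) | ⟨⟨s, e, k, b⟩, h⟩) |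
      ⟨⟨⟨u, v, b, m, p, q, c⟩, s, e, k, i⟩, ⟨⟨hB, -⟩, hi⟩, h⟩) |
      ⟨⟨⟨u, v, b, m, p, q, c⟩, s, e, k⟩, ⟨hB, -⟩, h⟩) | ⟨⟨s, e, k, b, m, p, q⟩, h⟩) |
      ⟨⟨s, e, k, b, m, p, q, c⟩, h⟩ <;>
    (cases h; simp only [List.forall_mem_cons, List.not_mem_nil, false_imp_iff, implies_true,
      and_true] at ih)
    · intro n x ψ hψ hb
      replace ht : TermApprox t b e (atomNumerator s _) := ht
      cases g <;> cases ψ <;>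
        simp only [QFFormula.code, Nat.pair_eq_pair, cond_true, cond_false,
          OfNat.zero_ne_ofNat, OfNat.one_ne_ofNat, zero_ne_one, one_ne_zero,
          false_and, true_and] at hψ <;>
        (subst hψ; exact derivedSign_of_abs_sub_lt (ht.abs_sub_lt hM hb))
    · intro n x ψ hψ hb
      cases s <;> cases ψ <;> simp [QFFormula.code, Nat.pair_eq_pair] at hψ <;>
        exact ⟨ih.1 n x _ hψ.1 hb, ih.2 n x _ hψ.2 hb⟩
    · intro n x ψ hψ hb
      cases s <;> cases ψ <;> simp [QFFormula.code, Nat.pair_eq_pair] at hψ <;> cases g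
      · exact .inr (ih n x _ hψ.2 hb)
      · exact .inl (ih n x _ hψ.1 hb)
      · exact .inr (ih n x _ hψ.2 hb)
      · exact .inl (ih n x _ hψ.1 hb)
    · intro n x φ hφ hb
      cases φ <;> simp [BddFormula.code, Nat.pair_eq_pair] at hφ
      exact ih n x _ hφ hb
    · intro n x φ hφ hb
      replace hB : BoundsApprox u v b m p q c := hB
      have key : ∀ (a a' : L.Term (Fin n)) (φ : BddFormula L (n + 1)),
          u = termCode M a ∧ v = termCode M a' ∧ k = φ.code M →
          ∃ y ∈ Set.uIcc (a.realize x) (a'.realize x),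
            φ.Sat (DerivedSign s e) s (Fin.snoc x y) := by
        rintro a a' φ ⟨rfl, rfl, rfl⟩
        obtain ⟨y, hy, hlt⟩ := (hB.gridNear hM hb).exists_mem_uIcc hi
        exact ⟨y, hy, ih _ _ φ rfl (hb.append_singleton hlt)⟩
      cases s <;> cases φ <;> simp [BddFormula.code, Nat.pair_eq_pair] at hφ <;>
        exact key _ _ _ hφ
    · intro n x φ hφ hb
      replace hB : BoundsApprox u v b m p q c := hB
      have key : ∀ (a a' : L.Term (Fin n)) (φ : BddFormula L (n + 1)),
          u = termCode M a ∧ v = termCode M a' ∧ k = φ.code M →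
          ∀ y ∈ Set.uIcc (a.realize x) (a'.realize x),
            φ.Sat (DerivedSign s e) s (Fin.snoc x y) := by
        rintro a a' φ ⟨rfl, rfl, rfl⟩ y hy
        obtain ⟨i, hi, hlt⟩ := (hB.gridNear hM hb).exists_gridPoint hy
        exact ih n x φ rfl hb i (Nat.lt_succ_of_le hi) y hlt
      cases s <;> cases φ <;> simp [BddFormula.code, Nat.pair_eq_pair] at hφ <;>
        exact key _ _ _ hφ
    · exact fun n x φ _ _ i hi => absurd hi (Nat.not_lt_zero i)
    · intro n x φ hφ hb i hi y hy
      cases i with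
      | zero => exact ih.1 _ _ φ hφ (hb.append_singleton hy)
      | succ i =>
        refine ih.2 n x φ hφ hb i (Nat.lt_of_succ_lt_succ hi) y ?_
        rwa [add_assoc, add_comm 1 i]

theorem BddDerivable.sat
    (hM : ∀ (k : ℕ) (f : L.Functions k),
      (M k f).Computes (fun x : Fin k → ℝ => FirstOrder.Language.Structure.funMap f x))
    {s : Bool} {e n : ℕ} {φ : BddFormula L n} {b : Box} (h : BddDerivable s e (φ.code M) b)
    {x : Fin n → ℝ} (hb : b.Contains x) : φ.Sat (DerivedSign s e) s x :=
  FormulaJudgment.holds_of_derivable hM h n x φ rfl hb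

end Soundness

/-! ### Completeness of the calculus for formulas -/

section Completeness

open Filter

variable {L : FirstOrder.Language.{u, v}} [L.Structure ℝ] {M : ∀ k, L.Functions k → OracleCode}

theorem Box.Near.of_dist_le {b : Box} {N N' n : ℕ} {x x' : Fin n → ℝ} (h : b.Near N x)
    (hx : ∀ j, |x j - x' j| + (2 : ℝ)⁻¹ ^ N ≤ (2 : ℝ)⁻¹ ^ N') : b.Near N' x' := by
  obtain ⟨f, rfl, hf⟩ := h.exists_ofFn_left
  refine List.forall₂_ofFn_iff.2 fun j => ?_
  have := abs_sub_le (dyadicVal (f j).1) (x j) (x' j)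
  linarith [hf j, hx j]

theorem Box.Near.mono {b : Box} {N N' n : ℕ} {x : Fin n → ℝ} (h : b.Near N x) (hN : N' ≤ N) :
    b.Near N' x :=
  h.of_dist_le fun j => by
    simpa using pow_le_pow_of_le_one (by norm_num : (0 : ℝ) ≤ 2⁻¹) (by norm_num) hN

theorem QFDerivable.eventually
    (hM : ∀ (k : ℕ) (f : L.Functions k),
      (M k f).Computes (fun x : Fin k → ℝ => FirstOrder.Language.Structure.funMap f x))
    {s : Bool} {e n : ℕ} {x : Fin n → ℝ} {ψ : QFFormula L n}
    (h : ψ.Sat (DerivableSign s e) s x) :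
    ∀ᶠ N in atTop, ∀ b : Box, b.Near N x → QFDerivable s e (ψ.code M) b := by
  have hconj {φ ψ : QFFormula L n}
      (h₁ : ∀ᶠ N in atTop, ∀ b : Box, b.Near N x → QFDerivable s e (φ.code M) b)
      (h₂ : ∀ᶠ N in atTop, ∀ b : Box, b.Near N x → QFDerivable s e (ψ.code M) b) :
      ∀ᶠ N in atTop, ∀ b : Box, b.Near N x →
        QFDerivable s e (Nat.pair (bif s then 2 else 3) (Nat.pair (φ.code M) (ψ.code M))) b := by
    filter_upwards [h₁, h₂] with N h₁ h₂ b hb using .conj (h₁ b hb) (h₂ b hb)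
  have hdisj {φ ψ : QFFormula L n}
      (h : (∀ᶠ N in atTop, ∀ b : Box, b.Near N x → QFDerivable s e (φ.code M) b) ∨
        ∀ᶠ N in atTop, ∀ b : Box, b.Near N x → QFDerivable s e (ψ.code M) b) :
      ∀ᶠ N in atTop, ∀ b : Box, b.Near N x →
        QFDerivable s e (Nat.pair (bif s then 3 else 2) (Nat.pair (φ.code M) (ψ.code M))) b := by
    rcases h with h | h
    · filter_upwards [h] with N h b hb using .disj true (h b hb)
    · filter_upwards [h] with N h b hb using .disj false (h b hb)
  induction ψ with
  | pos t =>
    obtain ⟨n, hn⟩ := exists_atomNumerator h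
    filter_upwards [TermApprox.eventually hM x t hn] with N hN b hb using .atom true (hN b hb)
  | nonneg t =>
    obtain ⟨n, hn⟩ := exists_atomNumerator h
    filter_upwards [TermApprox.eventually hM x t hn] with N hN b hb using .atom false (hN b hb)
  | and φ ψ ih₁ ih₂ =>
    cases s with
    | true => exact hconj (ih₁ h.1) (ih₂ h.2)
    | false => exact hdisj (h.imp ih₁ ih₂)
  | or φ ψ ih₁ ih₂ =>
    cases s with
    | true => exact hdisj (h.imp ih₁ ih₂)
    | false => exact hconj (ih₁ h.1) (ih₂ h.2)

theorem BoundsApprox.eventually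
    (hM : ∀ (k : ℕ) (f : L.Functions k),
      (M k f).Computes (fun x : Fin k → ℝ => FirstOrder.Language.Structure.funMap f x))
    {n : ℕ} {x : Fin n → ℝ} {a a' : L.Term (Fin n)} {m p q c : ℕ}
    (h : GridNear (a.realize x) (a'.realize x) m p q c) :
    ∀ᶠ N in atTop, ∀ b : Box, b.Near N x →
      BoundsApprox (termCode M a) (termCode M a') b m p q c := by
  rcases h with ⟨h₁, h₂⟩ | ⟨h₁, h₂⟩
  · filter_upwards [TermApprox.eventually hM x a h₁, TermApprox.eventually hM x a' h₂]
      with N h₁ h₂ b hb using .inl ⟨h₁ b hb, h₂ b hb⟩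
  · filter_upwards [TermApprox.eventually hM x a h₁, TermApprox.eventually hM x a' h₂]
      with N h₁ h₂ b hb using .inr ⟨h₁ b hb, h₂ b hb⟩

/-- At level `N + 1` the radius of the ball and the distance of its centre from `y` together stay
below `2⁻ᴺ`. -/
theorem Box.Near.append_gridPoint {b : Box} {N n p q : ℕ} {x : Fin n → ℝ} (h : b.Near N x) {y : ℝ}
    (hy : |dyadicVal (gridPoint p q (N + 1)) - y| < (2 : ℝ)⁻¹ ^ (N + 1)) :
    Box.Near (b ++ [(gridPoint p q (N + 1), N + 1)]) N (Fin.snoc x y : Fin (n + 1) → ℝ) := by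
  refine List.Forall₂.append_singleton h ?_
  have : (2 : ℝ)⁻¹ ^ N = 2 * (2 : ℝ)⁻¹ ^ (N + 1) := by rw [pow_succ]; ring
  dsimp only
  linarith

variable {s : Bool} {e n : ℕ} {x : Fin n → ℝ} {a a' : L.Term (Fin n)} {φ : BddFormula L (n + 1)}

/-- The level of the grid is dictated by the witness `y`; only afterwards is the box around `x`
shrunk until it certifies the ends of that grid. -/
theorem BddDerivable.eventually_ex
    (hM : ∀ (k : ℕ) (f : L.Functions k),
      (M k f).Computes (fun x : Fin k → ℝ => FirstOrder.Language.Structure.funMap f x))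
    (h : ∃ y ∈ Set.uIcc (a.realize x) (a'.realize x), ∀ᶠ N in atTop, ∀ b : Box,
      b.Near N (Fin.snoc x y : Fin (n + 1) → ℝ) → BddDerivable s e (φ.code M) b) :
    ∀ᶠ N in atTop, ∀ b : Box, b.Near N x → BddDerivable s e (Nat.pair (bif s then 1 else 2)
      (Nat.pair (termCode M a) (Nat.pair (termCode M a') (φ.code M)))) b := by
  obtain ⟨y, hy, h⟩ := h
  obtain ⟨N, hN⟩ := h.exists
  obtain ⟨p, q, c, hg⟩ := exists_gridNear (a.realize x) (a'.realize x) (N + 1)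
  obtain ⟨i, hi, hlt⟩ := hg.exists_gridPoint hy
  filter_upwards [BoundsApprox.eventually hM hg, eventually_ge_atTop N] with N' hB hN' b hb
  exact .ex (hB b hb) hi (hN _ ((hb.mono hN').append_gridPoint hlt))

/-- For each `y` the premise is derivable on small boxes, at a scale that depends on `y`.
Compactness of the interval gives a scale `N` valid for all `y` at once, and hence one finite grid
of level `N + 1`, each of whose balls is close to some point of the interval. -/
theorem BddDerivable.eventually_all
    (hM : ∀ (k : ℕ) (f : L.Functions k),
      (M k f).Computes (fun x : Fin k → ℝ => FirstOrder.Language.Structure.funMap f x))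
    (h : ∀ y ∈ Set.uIcc (a.realize x) (a'.realize x), ∀ᶠ N in atTop, ∀ b : Box,
      b.Near N (Fin.snoc x y : Fin (n + 1) → ℝ) → BddDerivable s e (φ.code M) b) :
    ∀ᶠ N in atTop, ∀ b : Box, b.Near N x → BddDerivable s e (Nat.pair (bif s then 2 else 1)
      (Nat.pair (termCode M a) (Nat.pair (termCode M a') (φ.code M)))) b := by
  have hunif : ∀ᶠ N in atTop, ∀ y ∈ Set.uIcc (a.realize x) (a'.realize x), ∀ b : Box,
      b.Near N (Fin.snoc x y : Fin (n + 1) → ℝ) → BddDerivable s e (φ.code M) b := by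
    refine isCompact_uIcc.induction_on (p := fun S => ∀ᶠ N in atTop, ∀ y ∈ S, ∀ b : Box,
      b.Near N (Fin.snoc x y : Fin (n + 1) → ℝ) → BddDerivable s e (φ.code M) b) ?_ ?_ ?_ ?_
    · exact .of_forall fun N y hy => absurd hy (Set.notMem_empty y)
    · exact fun S T hST hT => hT.mono fun N hN y hy => hN y (hST hy)
    · intro S T hS hT
      filter_upwards [hS, hT] with N hS hT y hy using hy.elim (hS y) (hT y)
    · intro y hy
      obtain ⟨N, hN⟩ := (h y hy).exists
      -- If `y'` is in this ball, a box near `(x, y')` at a level of at least `N + 1` is near `(x,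
      -- y)` at level `N`: two halves of `2⁻ᴺ` add up.
      refine ⟨Metric.ball y ((2 : ℝ)⁻¹ ^ (N + 1)),
        mem_nhdsWithin_of_mem_nhds (Metric.ball_mem_nhds y (inv_two_pow_pos _)), ?_⟩
      filter_upwards [eventually_ge_atTop (N + 1)] with N' hN' y' hy' b hb
      have hpow : (2 : ℝ)⁻¹ ^ N' ≤ (2 : ℝ)⁻¹ ^ (N + 1) :=
        pow_le_pow_of_le_one (by norm_num) (by norm_num) hN'
      have h2 : (2 : ℝ)⁻¹ ^ N = 2 * (2 : ℝ)⁻¹ ^ (N + 1) := by rw [pow_succ]; ring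
      have hpos := inv_two_pow_pos (N + 1)
      refine hN b (hb.of_dist_le fun j => ?_)
      refine Fin.lastCases ?_ (fun j => ?_) j
      · rw [Metric.mem_ball, Real.dist_eq] at hy'
        simp only [Fin.snoc_last]
        linarith
      · simp only [Fin.snoc_castSucc, sub_self, abs_zero]
        linarith
  obtain ⟨N, hN⟩ := hunif.exists
  obtain ⟨p, q, c, hg⟩ := exists_gridNear (a.realize x) (a'.realize x) (N + 1)
  filter_upwards [BoundsApprox.eventually hM hg, eventually_ge_atTop N] with N' hB hN' b hb
  refine .all (hB b hb) (.of_forall fun i hi => ?_)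
  obtain ⟨y, hy, hlt⟩ := hg.exists_mem_uIcc (Nat.lt_succ_iff.1 hi)
  exact hN y hy _ ((hb.mono hN').append_gridPoint hlt)

end Completeness

section Sentences

open Filter

variable {L : FirstOrder.Language.{u, v}} [L.Structure ℝ] {M : ∀ k, L.Functions k → OracleCode}

theorem BddDerivable.eventually
    (hM : ∀ (k : ℕ) (f : L.Functions k),
      (M k f).Computes (fun x : Fin k → ℝ => FirstOrder.Language.Structure.funMap f x))
    {s : Bool} {e n : ℕ} {x : Fin n → ℝ} {φ : BddFormula L n}
    (h : φ.Sat (DerivableSign s e) s x) :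
    ∀ᶠ N in atTop, ∀ b : Box, b.Near N x → BddDerivable s e (φ.code M) b := by
  induction φ with
  | matrix ψ =>
    filter_upwards [QFDerivable.eventually hM h] with N hN b hb using .matrix (hN b hb)
  | ex a a' φ ih =>
    cases s with
    | true => exact BddDerivable.eventually_ex hM (Exists.imp (fun y => And.imp_right ih) h)
    | false => exact BddDerivable.eventually_all hM fun y hy => ih (h y hy)
  | all a a' φ ih =>
    cases s with
    | true => exact BddDerivable.eventually_all hM fun y hy => ih (h y hy)
    | false => exact BddDerivable.eventually_ex hM (Exists.imp (fun y => And.imp_right ih) h)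

/-- The empty box is near the empty point at every level, so no shrinking is left to do. -/
theorem BddDerivable.of_sentence
    (hM : ∀ (k : ℕ) (f : L.Functions k),
      (M k f).Computes (fun x : Fin k → ℝ => FirstOrder.Language.Structure.funMap f x))
    {s : Bool} {e : ℕ} {φ : BddSentence L} (h : φ.Sat (DerivableSign s e) s ![]) :
    BddDerivable s e (φ.code M) [] := by
  obtain ⟨N, hN⟩ := (BddDerivable.eventually hM h).exists
  exact hN [] .nil

end Sentences

end RealLogic

/-- Since `δ ≥ 1 / δ.den ≥ 2⁻¹ ^ δ.den`, the denominator alone yields a sufficient precision. -/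
theorem inv_two_pow_den_le {δ : ℚ} (hδ : 0 < δ) : (2 : ℝ)⁻¹ ^ δ.den ≤ δ := by
  have hden : (0 : ℝ) < δ.den := by exact_mod_cast δ.pos
  have hnum : (1 : ℝ) ≤ δ.num := by exact_mod_cast Rat.num_pos.2 hδ
  have hlt : (δ.den : ℝ) ≤ 2 ^ δ.den := by exact_mod_cast Nat.lt_two_pow_self.le
  rw [Rat.cast_def, inv_pow, inv_eq_one_div]
  gcongr

theorem mainTheorem6 :
    ∃ D : ℕ × ℕ × ℕ →. Bool, Partrec D ∧
      ∀ (L : FirstOrder.Language.{u, v}) [L.Structure ℝ] (B : RealLogic.BasicSymbols L)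
        (M : ∀ k, L.Functions k → OracleCode),
        (∀ (k : ℕ) (f : L.Functions k),
          (M k f).Computes (fun x : Fin k → ℝ => FirstOrder.Language.Structure.funMap f x)) →
        ∀ (δ : ℚ), 0 < δ → ∀ φ : RealLogic.BddSentence L, φ.IsRobust B δ →
          ∃ b ∈ D (δ.num.natAbs, δ.den, φ.code M), (b = true ↔ φ.IsTrue) := by
  -- The algorithm is fixed before the language: it races the two judgments about the given sentence
  -- number on the empty box, with the denominator of `δ` as precision.
  obtain ⟨D, hD, h⟩ :=
    RealLogic.effectivelyEnumerable_derivable_formulaRules.exists_partrec_race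
      (f := fun x : ℕ × ℕ × ℕ => .inr (.inl (true, x.2.1, x.2.2, [])))
      (g := fun x : ℕ × ℕ × ℕ => .inr (.inl (false, x.2.1, x.2.2, [])))
      (by fun_prop) (by fun_prop)
  refine ⟨D, hD, fun L _ B M hM δ hδ φ hφ => ?_⟩
  have hor : RealLogic.BddDerivable true δ.den (φ.code M) [] ∨
      RealLogic.BddDerivable false δ.den (φ.code M) [] := by
    -- The conditions guaranteeing a positive and a negative derivation, `-ε < r` and `r ≤ -ε`, are
    -- exact complements, so duality leaves no gap.
    by_cases hsat : φ.Sat (RealLogic.DerivableSign true δ.den) true ![]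
    · exact .inl (.of_sentence hM hsat)
    · refine .inr (.of_sentence hM ?_)
      convert RealLogic.BddFormula.sat_false_of_not_sat_true hsat using 2
      simp [RealLogic.DerivableSign]
  obtain ⟨b, hb, htrue, hfalse⟩ := h (δ.num.natAbs, δ.den, φ.code M) hor
  refine ⟨b, hb, ?_⟩
  cases b with
  | true =>
    -- Only the answer `true` relies on robustness: the derivation gives the weakened sentence. A
    -- negative derivation refutes `φ` itself.
    refine iff_of_true rfl (hφ ?_)
    refine RealLogic.BddFormula.realize_weaken_of_sat_true B (fun r hr => ?_)
      (RealLogic.BddDerivable.sat hM (htrue rfl) (x := ![]) .nil)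
    exact (neg_le_neg (inv_two_pow_den_le hδ)).trans_lt hr
  | false =>
    refine iff_of_false (by simp) ?_
    exact RealLogic.BddFormula.not_realize_of_sat_false (fun r hr => hr)
      (RealLogic.BddDerivable.sat hM (hfalse rfl) (x := ![]) .nil)
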